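/- Let $P_0(\xi)=\sum_{|\alpha|\le m}a_\alpha\xi^\alpha$ be a polynomial on $\mathbb{R}^n$ with real coefficients and degree $m\ge 2$, and let $P_0=P_0(D)=\sum_\alpha a_\alpha D^\alpha$, $D_j=-i\,\partial/\partial x_j$. Assume that $\widetilde P_0(\xi)=\big(\sum_{\alpha}|\partial^{\alpha}P_0(\xi)|^2\big)^{1/2}\to\infty$ as $|\xi|\to\infty$. For a bounded open set $\Omega\subset\mathbb{R}^n$ let $H^{P_0}_0(\Omega)$ be the completion of $C_0^\infty(\Omega)$ with respect to the norm $\|\varphi\|_{P_0}=\|P_0(D)\varphi\|_{L^2}$, regarded as a subspace of $L^2(\Omega)$ (on $C_0^\infty(\Omega)$ one has $\|\varphi\|_{L^2}\le C_\Omega\|P_0(D)\varphi\|_{L^2}$). For a bounded real-valued function $V$, call $\lambda\in\mathbb{C}$ a transmission eigenvalue of the acoustic problem on $\Omega$ with potential $V$ if there are $0\ne v\in L^2_{\mathrm{loc}}(\Omega)$ and $0\ne w\in L^2_{\mathrm{loc}}(\Omega)$ with $$(P_0-\lambda)v=0\ \text{ in }\Omega,\qquad (P_0-\lambda(1+V))w=0\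 \text{ in }\Omega,\qquad v-w\in H^{P_0}_0(\Omega),$$ the equations being understood in the sense of distributions. Let $\Omega\subset\mathbb{R}^n$ be a bounded domain (a non-empty connected open set), and let $V\in L^\infty(\mathbb{R}^n)$ be real-valued with $\operatorname{supp}V=\overline\Omega$ and $V\ge\delta_0$ a.e. in $\overline\Omega$ for some constant $\delta_0>0$. Suppose that for every $\varepsilon>0$ and every $\delta>0$ the acoustic problem on the open ball $B_\varepsilon(0)\subset\mathbb{R}^n$ of radius $\varepsilon$ centred at the origin, with constant potential $\delta$, has a non-zero real transmission eigenvalue. Then the set of real transmission eigenvalues of the acoustic problem on $\Omega$ with potential $V$ is infinite. -/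

import Mathlib

open MeasureTheory Filter Topology
open scoped Distributions ENNReal

noncomputable section

namespace AcousticITP

/-- `ℝⁿ` with the Euclidean norm. -/
abbrev Rn (n : ℕ) : Type := EuclideanSpace ℝ (Fin n)

/-- The operator `D_j = -i ∂/∂x_j` on complex valued functions on `ℝⁿ`. -/
def D {n : ℕ} (j : Fin n) (f : Rn n → ℂ) : Rn n → ℂ :=
  fun x => -Complex.I * fderiv ℝ f x (EuclideanSpace.single j 1)

/-- The operator `D^α = D_1^{α_1} ⋯ D_n^{α_n}` for a multi-index `α`. -/
def multiD {n : ℕ} (α : Fin n → ℕ) (f : Rn n → ℂ) : Rn n → ℂ :=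
  (List.finRange n).foldr (fun j g => (D j)^[α j] g) f

/-- The constant coefficient operator `P(D) = ∑_α a_α D^α` attached to the real polynomial
`P(ξ) = ∑_α a_α ξ^α` (its symbol), acting on smooth functions. -/
def diffOp {n : ℕ} (P : MvPolynomial (Fin n) ℝ) (f : Rn n → ℂ) : Rn n → ℂ :=
  fun x => ∑ α ∈ P.support, ((P.coeff α : ℝ) : ℂ) * multiD α f x

/-- The transpose `P(-D) = ∑_α a_α (-1)^{|α|} D^α` of `P(D)` for the bilinear pairing
`∫ f g`. -/
def transposeOp {n : ℕ} (P : MvPolynomial (Fin n) ℝ) (f : Rn n → ℂ) : Rn n → ℂ :=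
  fun x => ∑ α ∈ P.support, ((P.coeff α : ℝ) : ℂ) * (-1) ^ (∑ j, α j) * multiD α f x

/-- `P^{(α)}`, the derivative of order `α` of the polynomial `P`. -/
def polyDeriv {n : ℕ} (α : Fin n → ℕ) (P : MvPolynomial (Fin n) ℝ) :
    MvPolynomial (Fin n) ℝ :=
  (List.finRange n).foldr (fun j Q => (MvPolynomial.pderiv j)^[α j] Q) P

/-- Hörmander's weight `P̃(ξ) = (∑_α |P^{(α)}(ξ)|²)^{1/2}`. The sum over all multi-indices reduces
to those with entries at most the degree of `P`, as the other derivatives of `P` vanish. -/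
def weight {n : ℕ} (P : MvPolynomial (Fin n) ℝ) (ξ : Rn n) : ℝ :=
  Real.sqrt (∑ α ∈ Fintype.piFinset fun _ : Fin n => Finset.range (P.totalDegree + 1),
    (MvPolynomial.eval (fun j => ξ j) (polyDeriv α P)) ^ 2)

/-- `u ∈ H^P_0(Ω)`, the completion of `C_0^∞(Ω)` for the norm `‖φ‖_P = ‖P(D)φ‖_{L²}`. As `Ω` is
bounded, `‖φ‖_{L²} ≤ C ‖P(D)φ‖_{L²}` on `C_0^∞(Ω)`, and the completion is the space of the `L²`
limits of the sequences in `C_0^∞(Ω)` that are Cauchy for `‖·‖_P`. -/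
def MemH0 {n : ℕ} (P : MvPolynomial (Fin n) ℝ) (Ω : TopologicalSpace.Opens (Rn n))
    (u : Rn n → ℂ) : Prop :=
  MemLp u 2 (volume.restrict (Ω : Set (Rn n))) ∧
  ∃ φ : ℕ → 𝓓(Ω, ℂ),
    Tendsto (fun k => eLpNorm (fun x => φ k x - u x) 2 (volume.restrict (Ω : Set (Rn n))))
      atTop (𝓝 0) ∧
    Tendsto (fun p : ℕ × ℕ => eLpNorm (fun x => diffOp P (φ p.1 - φ p.2 : 𝓓(Ω, ℂ)) x) 2 volume)
      atTop (𝓝 0)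

/-- `u ∈ L²_loc(Ω)`. -/
def MemL2Loc {n : ℕ} (Ω : TopologicalSpace.Opens (Rn n)) (u : Rn n → ℂ) : Prop :=
  ∀ K : Set (Rn n), IsCompact K → K ⊆ Ω → MemLp u 2 (volume.restrict K)

/-- `(P(D) - q) u = 0` in the sense of distributions on `Ω`. -/
def SolvesIn {n : ℕ} (P : MvPolynomial (Fin n) ℝ) (Ω : TopologicalSpace.Opens (Rn n))
    (q : Rn n → ℂ) (u : Rn n → ℂ) : Prop :=
  ∀ φ : 𝓓(Ω, ℂ), ∫ x in (Ω : Set (Rn n)), u x * (transposeOp P φ x - q x * φ x) = 0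

/-- `μ` is a transmission eigenvalue of the acoustic interior transmission problem
`(P(D) - μ) v = 0` in `Ω`, `(P(D) - μ (1 + V)) w = 0` in `Ω`, `v - w ∈ H^P_0(Ω)`: it has a solution
with `0 ≠ v ∈ L²_loc(Ω)` and `0 ≠ w ∈ L²_loc(Ω)`. -/
def IsTransmissionEigenvalue {n : ℕ} (P : MvPolynomial (Fin n) ℝ)
    (Ω : TopologicalSpace.Opens (Rn n)) (V : Rn n → ℝ) (μ : ℂ) : Prop :=
  ∃ v w : Rn n → ℂ,
    MemL2Loc Ω v ∧ MemL2Loc Ω w ∧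
    (¬ v =ᵐ[volume.restrict (Ω : Set (Rn n))] 0) ∧
    (¬ w =ᵐ[volume.restrict (Ω : Set (Rn n))] 0) ∧
    SolvesIn P Ω (fun _ => μ) v ∧
    SolvesIn P Ω (fun x => μ * (1 + (V x : ℂ))) w ∧
    MemH0 P Ω (fun x => v x - w x)

/-- The open ball `B_ε(0)` in `ℝⁿ`. -/
def ballO (n : ℕ) (ε : ℝ) : TopologicalSpace.Opens (Rn n) :=
  ⟨Metric.ball 0 ε, Metric.isOpen_ball⟩

/-- The support of (the class of) a measurable function: the complement of the largest open set on
which it vanishes almost everywhere. -/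
def essSupport {n : ℕ} (V : Rn n → ℝ) : Set (Rn n) :=
  (volume.withDensity fun x => ‖V x‖ₑ).support

end AcousticITP

end

/-!
On the closure `H` of the graph of `P(D)` over the test functions on `Ω`, the form
`∫ V⁻¹ |(P(D) - t) u|² - t ∫ (P(D) - t) u ū` defines self-adjoint operators `T t`, which depend
continuously on `t` and, since `P̃ → ∞` makes `H` compactly embedded in `L²`, are coercive on a
subspace of finite codimension. For real `t ≠ 0`, a nonzero kernel of `T t` yields the transmission
eigenvalue `t`: if `(P(D) - t) u = -t V w`, then `w` and `v = u + w` solve the problem, and neither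
vanishes because an element of `H` with `|P(D) u| ≤ K |u|` is zero, by a Carleman estimate with the
weight `exp (τ x_j)`.

If there were only finitely many real transmission eigenvalues, the dimension of the subspaces on
which the form of `T t` is nonpositive would be bounded uniformly in `t`: it is locally bounded, and
locally constant where `T t` is invertible. But an eigenfunction of a small ball with the constant
potential `δ₀ ≤ V` makes this form nonpositive, and `Ω` contains any number of disjoint translates
of a small enough ball.
-/

noncomputable section

namespace AcousticITP

open MvPolynomial TopologicalSpace
open Complex (I)
open scoped ComplexConjugate InnerProductSpace

/-! ### Constant coefficient operators on test functions -/

variable {n : ℕ} {Ω : Opens (Rn n)}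

theorem contDiff_D (j : Fin n) {f : Rn n → ℂ} (hf : ContDiff ℝ (⊤ : ℕ∞) f) :
    ContDiff ℝ (⊤ : ℕ∞) (D j f) :=
  contDiff_const.mul ((hf.fderiv_right (by simp)).clm_apply contDiff_const)

theorem tsupport_D_subset (j : Fin n) (f : Rn n → ℂ) : tsupport (D j f) ⊆ tsupport f :=
  tsupport_mul_subset_right.trans (tsupport_fderiv_apply_subset ℝ (EuclideanSpace.single j 1))

theorem differentiable_testFunction (f : 𝓓(Ω, ℂ)) : Differentiable ℝ f :=
  f.contDiff.differentiable (by simp)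

/-- `D_j` acting on test functions. -/
def testD (j : Fin n) : Module.End ℂ 𝓓(Ω, ℂ) where
  toFun f := ⟨D j f, contDiff_D j f.contDiff,
    f.hasCompactSupport.mono' ((subset_tsupport _).trans (tsupport_D_subset j f)),
    (tsupport_D_subset j f).trans f.tsupport_subset⟩
  map_add' f g := by
    ext x
    change -I * fderiv ℝ (⇑f + ⇑g) x _ = -I * fderiv ℝ f x _ + -I * fderiv ℝ g x _
    rw [fderiv_add (differentiable_testFunction f x) (differentiable_testFunction g x),
      add_apply, mul_add]
  map_smul' c f := by
    ext x
    change -I * fderiv ℝ (c • ⇑f) x _ = c * (-I * fderiv ℝ f x _)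
    rw [fderiv_const_smul (differentiable_testFunction f x), smul_apply, smul_eq_mul,
      mul_left_comm]

theorem testD_apply (j : Fin n) (f : 𝓓(Ω, ℂ)) (x : Rn n) : testD j f x = D j f x := rfl

theorem D_D_apply (a b : Fin n) (f : 𝓓(Ω, ℂ)) (x : Rn n) :
    D a (D b f) x =
      -fderiv ℝ (fderiv ℝ f) x (EuclideanSpace.single a 1) (EuclideanSpace.single b 1) := by
  have hd : DifferentiableAt ℝ (fderiv ℝ f) x :=
    (f.contDiff.fderiv_right (m := 1) (by norm_cast)).differentiable (by simp) x
  unfold D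
  rw [fderiv_const_mul (hd.clm_apply (differentiableAt_const _)),
    fderiv_clm_apply hd (differentiableAt_const _)]
  simp [← mul_assoc]

theorem testD_comm (j k : Fin n) : testD (Ω := Ω) j * testD k = testD k * testD j := by
  ext f x
  change D j (D k f) x = D k (D j f) x
  have hsymm : IsSymmSndFDerivAt ℝ f x :=
    f.contDiff.contDiffAt.isSymmSndFDerivAt (by
      rw [minSmoothness_of_isRCLikeNormedField]
      exact WithTop.coe_le_coe.2 (le_top (a := (2 : ℕ∞))))
  rw [D_D_apply, D_D_apply, hsymm]

instance isMulCommutative_adjoin_testD :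
    IsMulCommutative (Algebra.adjoin ℂ (Set.range (testD (Ω := Ω)))) :=
  Algebra.isMulCommutative_adjoin ℂ (by rintro _ ⟨i, rfl⟩ _ ⟨j, rfl⟩; exact testD_comm i j)

open scoped IsMulCommutative in
/-- The constant coefficient operator `Q(D)` on test functions, for a complex polynomial `Q`. The
operators `D_j` generate a commutative algebra, in which the polynomials can be evaluated. -/
def polyOp : MvPolynomial (Fin n) ℂ →ₐ[ℂ] Module.End ℂ 𝓓(Ω, ℂ) :=
  (Algebra.adjoin ℂ (Set.range (testD (Ω := Ω)))).val.comp
    (aeval fun j => (⟨testD j, Algebra.subset_adjoin ⟨j, rfl⟩⟩ :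
      Algebra.adjoin ℂ (Set.range (testD (Ω := Ω)))))

open scoped IsMulCommutative in
theorem polyOp_X (j : Fin n) (f : 𝓓(Ω, ℂ)) : polyOp (X j) f = testD j f :=
  congrArg (fun A : Algebra.adjoin ℂ (Set.range (testD (Ω := Ω))) => A.val f) (aeval_X _ j)

theorem polyOp_C (c : ℂ) (f : 𝓓(Ω, ℂ)) : polyOp (C c) f = c • f := by
  rw [← algebraMap_eq, AlgHom.commutes, Module.algebraMap_end_apply]

theorem polyOp_mul (p q : MvPolynomial (Fin n) ℂ) (f : 𝓓(Ω, ℂ)) :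
    polyOp (p * q) f = polyOp p (polyOp q f) := by
  rw [map_mul, Module.End.mul_apply]

theorem polyOp_add (p q : MvPolynomial (Fin n) ℂ) (f : 𝓓(Ω, ℂ)) :
    polyOp (p + q) f = polyOp p f + polyOp q f := by
  rw [map_add, LinearMap.add_apply]

theorem polyOp_polyOp_comm (p q : MvPolynomial (Fin n) ℂ) (f : 𝓓(Ω, ℂ)) :
    polyOp p (polyOp q f) = polyOp q (polyOp p f) := by
  rw [← polyOp_mul, mul_comm, polyOp_mul]

/-- The complexification of a real polynomial. -/
abbrev cx {σ : Type*} (P : MvPolynomial σ ℝ) : MvPolynomial σ ℂ :=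
  map Complex.ofRealHom P

theorem coe_polyOp_X_pow (j : Fin n) (k : ℕ) (f : 𝓓(Ω, ℂ)) :
    ⇑(polyOp (X j ^ k) f) = (D j)^[k] f := by
  induction k generalizing f with
  | zero => simp
  | succ k ih => rw [pow_succ, polyOp_mul, ih, polyOp_X, Function.iterate_succ_apply]; rfl

theorem coe_polyOp_monomial_one (α : Fin n →₀ ℕ) (f : 𝓓(Ω, ℂ)) :
    ⇑(polyOp (monomial α 1) f) = multiD α f := by
  have hlist : ∀ l : List (Fin n), ⇑(polyOp (l.map fun j => X j ^ α j).prod f) =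
      l.foldr (fun j g => (D j)^[α j] g) f := by
    intro l
    induction l with
    | nil => simp
    | cons j l ih =>
      rw [List.map_cons, List.prod_cons, polyOp_mul, coe_polyOp_X_pow, ih, List.foldr_cons]
  rw [monomial_eq, C_1, one_mul, Finsupp.prod_fintype _ _ fun _ => pow_zero _, Fin.prod_univ_def,
    hlist, multiD]

theorem polyOp_monomial (α : Fin n →₀ ℕ) (c : ℂ) (f : 𝓓(Ω, ℂ)) :
    polyOp (monomial α c) f = c • polyOp (monomial α 1) f := by
  rw [← polyOp_C, ← polyOp_mul, C_mul_monomial, mul_one]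

theorem polyOp_cx_eq_sum (P : MvPolynomial (Fin n) ℝ) (f : 𝓓(Ω, ℂ)) :
    polyOp (cx P) f = ∑ α ∈ P.support, ((P.coeff α : ℝ) : ℂ) • polyOp (monomial α 1) f := by
  conv_lhs => rw [P.as_sum]
  simp only [map_sum, map_monomial, LinearMap.sum_apply, Complex.ofRealHom_eq_coe]
  exact Finset.sum_congr rfl fun α _ => polyOp_monomial α _ f

theorem sum_testFunction_apply {ι : Type*} (s : Finset ι) (f : ι → 𝓓(Ω, ℂ)) (x : Rn n) :
    (∑ i ∈ s, f i) x = ∑ i ∈ s, f i x :=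
  map_sum (⟨⟨fun f => f x, rfl⟩, fun _ _ => rfl⟩ : 𝓓(Ω, ℂ) →+ ℂ) f s

theorem diffOp_eq_polyOp (P : MvPolynomial (Fin n) ℝ) (f : 𝓓(Ω, ℂ)) :
    diffOp P f = polyOp (cx P) f := by
  ext x
  rw [polyOp_cx_eq_sum, sum_testFunction_apply]
  refine Finset.sum_congr rfl fun α _ => ?_
  rw [← coe_polyOp_monomial_one]
  rfl

section Conjugation

theorem D_conj (j : Fin n) {f : Rn n → ℂ} (hf : Differentiable ℝ f) (x : Rn n) :
    D j (fun y => conj (f y)) x = -conj (D j f x) := by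
  have hconj : fderiv ℝ (fun y => conj (f y)) x =
      (Complex.conjCLE : ℂ →L[ℝ] ℂ).comp (fderiv ℝ f x) :=
    (Complex.conjCLE.hasFDerivAt.comp x (hf x).hasFDerivAt).fderiv
  simp [D, hconj]

/-- Pointwise complex conjugation of test functions. -/
def conjTest : 𝓓(Ω, ℂ) →ₗ⋆[ℂ] 𝓓(Ω, ℂ) where
  toFun f := ⟨fun x => conj (f x), Complex.conjCLE.contDiff.comp f.contDiff,
    f.hasCompactSupport.comp_left (map_zero _),
    (tsupport_comp_subset (map_zero (starRingEnd ℂ)) f).trans f.tsupport_subset⟩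
  map_add' f g := by ext x; exact map_add conj (f x) (g x)
  map_smul' c f := by ext x; exact map_mul conj c (f x)

theorem conjTest_apply (f : 𝓓(Ω, ℂ)) (x : Rn n) : conjTest f x = conj (f x) := rfl

theorem conjTest_conjTest (f : 𝓓(Ω, ℂ)) : conjTest (conjTest f) = f := by
  ext x
  simp only [conjTest_apply, Complex.conj_conj]

theorem testD_conjTest (j : Fin n) (f : 𝓓(Ω, ℂ)) :
    testD j (conjTest f) = -conjTest (testD j f) := by
  ext x
  exact D_conj j (differentiable_testFunction f) x

theorem polyOp_monomial_conjTest (α : Fin n →₀ ℕ) (f : 𝓓(Ω, ℂ)) :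
    polyOp (monomial α 1) (conjTest f) =
      (-1 : ℂ) ^ α.degree • conjTest (polyOp (monomial α 1) f) := by
  induction α using Finsupp.induction_linear generalizing f with
  | zero => simp
  | add α β hα hβ =>
    rw [← one_mul (1 : ℂ), ← monomial_mul, polyOp_mul, hβ, map_smul, hα, polyOp_mul, smul_smul,
      map_add, pow_add, one_mul, mul_comm]
  | single j k =>
    rw [← X_pow_eq_monomial, Finsupp.degree_single]
    induction k generalizing f with
    | zero => simp
    | succ k ih =>
      rw [pow_succ, polyOp_mul, polyOp_mul, polyOp_X, testD_conjTest, map_neg, ih, polyOp_X,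
        pow_succ, mul_neg_one, neg_smul]

theorem transposeOp_eq_conjTest (P : MvPolynomial (Fin n) ℝ) (f : 𝓓(Ω, ℂ)) :
    transposeOp P f = conjTest (polyOp (cx P) (conjTest f)) := by
  ext x
  rw [polyOp_cx_eq_sum, map_sum, sum_testFunction_apply]
  refine Finset.sum_congr rfl fun α _ => ?_
  rw [polyOp_monomial_conjTest, smul_smul, map_smulₛₗ, conjTest_conjTest, map_mul,
    Complex.conj_ofReal, map_pow, map_neg, map_one, Finsupp.degree_eq_sum,
    ← coe_polyOp_monomial_one]
  rfl

end Conjugation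

section L2

/-- The space `L²(ℝⁿ)` of complex valued functions. -/
abbrev L2Rn (n : ℕ) : Type := Lp ℂ 2 (volume : Measure (Rn n))

theorem memLp_testFunction (f : 𝓓(Ω, ℂ)) : MemLp f 2 (volume : Measure (Rn n)) :=
  f.continuous.memLp_of_hasCompactSupport f.hasCompactSupport

/-- The embedding of the test functions in `L²(ℝⁿ)`. -/
def toL2 : 𝓓(Ω, ℂ) →ₗ[ℂ] L2Rn n where
  toFun f := (memLp_testFunction f).toLp f
  map_add' f g := MemLp.toLp_add (memLp_testFunction f) (memLp_testFunction g)
  map_smul' c f := MemLp.toLp_const_smul c (memLp_testFunction f)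

theorem coeFn_toL2 (f : 𝓓(Ω, ℂ)) : toL2 f =ᵐ[volume] f :=
  (memLp_testFunction f).coeFn_toLp

theorem inner_toL2_left (f : 𝓓(Ω, ℂ)) (g : L2Rn n) :
    ⟪toL2 f, g⟫_ℂ = ∫ x, g x * conj (f x) := by
  rw [L2.inner_def]
  refine integral_congr_ae ?_
  filter_upwards [coeFn_toL2 f] with x hf
  rw [hf, RCLike.inner_apply]

theorem inner_toL2 (f g : 𝓓(Ω, ℂ)) : ⟪toL2 f, toL2 g⟫_ℂ = ∫ x, g x * conj (f x) := by
  rw [inner_toL2_left]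
  refine integral_congr_ae ?_
  filter_upwards [coeFn_toL2 g] with x hg
  rw [hg]

theorem integrable_mul_testFunction (f g : 𝓓(Ω, ℂ)) : Integrable fun x => f x * g x :=
  (f.continuous.mul g.continuous).integrable_of_hasCompactSupport f.hasCompactSupport.mul_right

theorem integral_mul_testD (j : Fin n) (f g : 𝓓(Ω, ℂ)) :
    ∫ x, f x * testD j g x = -∫ x, testD j f x * g x := by
  have hparts : ∫ x, f x * fderiv ℝ g x (EuclideanSpace.single j 1) =
      -∫ x, fderiv ℝ f x (EuclideanSpace.single j 1) * g x := by
    refine integral_mul_fderiv_eq_neg_fderiv_mul_of_integrable ?_ ?_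
      (integrable_mul_testFunction f g) (fun x _ => differentiable_testFunction f x)
      fun x _ => differentiable_testFunction g x
    · refine ((integrable_mul_testFunction (testD j f) g).const_mul I).congr
        (ae_of_all _ fun x => ?_)
      simp [testD_apply, D, ← mul_assoc]
    · refine ((integrable_mul_testFunction f (testD j g)).const_mul I).congr
        (ae_of_all _ fun x => ?_)
      simp [testD_apply, D, ← mul_assoc, mul_right_comm I (f x) I]
  simp only [testD_apply, D, mul_left_comm (f _) (-I), mul_assoc (-I), integral_const_mul, hparts,
    mul_neg]

theorem inner_testD (j : Fin n) (f g : 𝓓(Ω, ℂ)) :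
    ⟪toL2 (testD j f), toL2 g⟫_ℂ = ⟪toL2 f, toL2 (testD j g)⟫_ℂ := by
  have hparts := integral_mul_testD j g (conjTest f)
  have hconj : ∀ x, testD j (conjTest f) x = -conj (testD j f x) := fun x =>
    congrArg (fun g : 𝓓(Ω, ℂ) => g x) (testD_conjTest j f)
  simp only [hconj, mul_neg, integral_neg, neg_inj] at hparts
  rw [inner_toL2, inner_toL2, hparts]
  rfl

theorem inner_polyOp (Q : MvPolynomial (Fin n) ℂ) (f g : 𝓓(Ω, ℂ)) :
    ⟪toL2 (polyOp Q f), toL2 g⟫_ℂ = ⟪toL2 f, toL2 (polyOp (map conj Q) g)⟫_ℂ := by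
  induction Q using MvPolynomial.induction_on generalizing f g with
  | C a => simp [inner_smul_left, inner_smul_right]
  | add p q hp hq => simp [inner_add_left, inner_add_right, hp, hq]
  | mul_X p j hp =>
    rw [polyOp_mul, polyOp_X, hp, inner_testD, map_mul, map_X, mul_comm, polyOp_mul, polyOp_X]

theorem map_conj_map_conj (Q : MvPolynomial (Fin n) ℂ) : map conj (map conj Q) = Q := by
  ext α
  simp only [coeff_map, Complex.conj_conj]

theorem inner_polyOp_cx (P : MvPolynomial (Fin n) ℝ) (f g : 𝓓(Ω, ℂ)) :
    ⟪toL2 (polyOp (cx P) f), toL2 g⟫_ℂ = ⟪toL2 f, toL2 (polyOp (cx P) g)⟫_ℂ := by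
  have hreal : map conj (cx P) = cx P := by
    ext α
    simp only [coeff_map, Complex.ofRealHom_eq_coe, Complex.conj_ofReal]
  rw [inner_polyOp, hreal]

theorem norm_polyOp_map_conj (Q : MvPolynomial (Fin n) ℂ) (f : 𝓓(Ω, ℂ)) :
    ‖toL2 (polyOp (map conj Q) f)‖ = ‖toL2 (polyOp Q f)‖ := by
  rw [← sq_eq_sq₀ (norm_nonneg _) (norm_nonneg _), ← Complex.ofReal_inj, Complex.ofReal_pow,
    Complex.ofReal_pow]
  simp only [← Complex.coe_algebraMap, ← inner_self_eq_norm_sq_to_K (𝕜 := ℂ)]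
  rw [inner_polyOp, inner_polyOp Q, map_conj_map_conj, polyOp_polyOp_comm]

end L2

/-! ### Unique continuation -/

section Polynomial

variable {σ R : Type*}

theorem pderiv_ne_zero_of_mem_vars [CommSemiring R] [CharZero R] [NoZeroDivisors R] {j : σ}
    {Q : MvPolynomial σ R} (hj : j ∈ Q.vars) : pderiv j Q ≠ 0 := by
  obtain ⟨m, hm, hmj⟩ := (mem_vars_iff_mem_support j).1 hj
  rw [Finsupp.mem_support_iff] at hmj
  intro h
  have hcoeff := coeff_pderiv (i := j) Q (m - Finsupp.single j 1)
  rw [h, coeff_zero,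
    tsub_add_cancel_of_le (Finsupp.single_le_iff.2 (Nat.one_le_iff_ne_zero.2 hmj))] at hcoeff
  exact mul_ne_zero (mem_support_iff.1 hm) (by norm_cast) hcoeff.symm

theorem exists_pderiv_ne_zero [CommSemiring R] [CharZero R] [NoZeroDivisors R]
    {Q : MvPolynomial σ R} (hQ : Q.totalDegree ≠ 0) : ∃ j, pderiv j Q ≠ 0 := by
  contrapose! hQ
  rw [totalDegree_eq_zero_iff]
  intro m hm j
  by_contra hmj
  refine pderiv_ne_zero_of_mem_vars ((mem_vars_iff_mem_support j).2 ⟨m, hm, ?_⟩) (hQ j)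
  exact Finsupp.mem_support_iff.2 hmj

theorem totalDegree_pderiv_lt [CommSemiring R] {Q : MvPolynomial σ R} (hQ : Q.totalDegree ≠ 0)
    (j : σ) : (pderiv j Q).totalDegree < Q.totalDegree := by
  rw [totalDegree, Finset.sup_lt_iff (by simpa using Nat.pos_of_ne_zero hQ)]
  intro m hm
  rw [mem_support_iff, coeff_pderiv] at hm
  have hle : (m + Finsupp.single j 1).degree ≤ Q.totalDegree :=
    le_totalDegree (mem_support_iff.2 (left_ne_zero_of_mul hm))
  rw [map_add, Finsupp.degree_single] at hle
  exact hle

theorem iterate_pderiv_eq_zero [CommSemiring R] (j : σ) {k : ℕ} {Q : MvPolynomial σ R}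
    (hk : Q.totalDegree < k) : (pderiv j)^[k] Q = 0 := by
  induction k generalizing Q with
  | zero => exact absurd hk (Nat.not_lt_zero _)
  | succ k ih =>
    rw [Function.iterate_succ_apply]
    by_cases hQ : Q.totalDegree = 0
    · rw [totalDegree_eq_zero_iff_eq_C.1 hQ, pderiv_C, iterate_map_zero]
    · exact ih (by have := totalDegree_pderiv_lt hQ j; omega)

theorem exists_iterate_pderiv_ne_zero [CommSemiring R] {j : σ} {Q : MvPolynomial σ R}
    (hj : pderiv j Q ≠ 0) :
    ∃ k, pderiv j ((pderiv j)^[k] Q) ≠ 0 ∧ pderiv j (pderiv j ((pderiv j)^[k] Q)) = 0 := by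
  obtain ⟨k, hk, hk'⟩ := Nat.exists_not_and_succ_of_not_zero_of_exists
    (p := fun k => pderiv j ((pderiv j)^[k] Q) = 0) hj
    ⟨_, by rw [iterate_pderiv_eq_zero j Q.totalDegree.lt_succ_self, map_zero]⟩
  exact ⟨k, hk, by rwa [Function.iterate_succ_apply'] at hk'⟩

theorem cx_iterate_pderiv (j : σ) (k : ℕ) (P : MvPolynomial σ ℝ) :
    cx ((pderiv j)^[k] P) = (pderiv j)^[k] (cx P) :=
  (show Function.Semiconj cx (pderiv j) (pderiv j) from
    fun _ => pderiv_map.symm).iterate_right k P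

section Shift

variable [DecidableEq σ]

/-- The substitution `ξ_j ↦ ξ_j + c` in polynomials, the other variables being fixed. -/
def shift [CommSemiring R] (c : R) (j : σ) : MvPolynomial σ R →ₐ[R] MvPolynomial σ R :=
  aeval fun k => X k + C (if k = j then c else 0)

theorem shift_X [CommSemiring R] (c : R) (j k : σ) :
    shift c j (X k) = X k + C (if k = j then c else 0) := aeval_X _ _

theorem pderiv_shift [CommSemiring R] (c : R) (j k : σ) (Q : MvPolynomial σ R) :
    pderiv k (shift c j Q) = shift c j (pderiv k Q) := by
  induction Q using MvPolynomial.induction_on with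
  | C a => simp [shift]
  | add p q hp hq => simp only [map_add, hp, hq]
  | mul_X p l hp =>
    rw [map_mul, shift_X, pderiv_mul, pderiv_mul, hp, map_add, map_add, map_mul, map_mul, shift_X,
      pderiv_C, add_zero, pderiv_X, Pi.single_apply]
    split_ifs <;> simp

theorem iterate_pderiv_shift [CommSemiring R] (c : R) (j k : σ) (m : ℕ) (Q : MvPolynomial σ R) :
    (pderiv k)^[m] (shift c j Q) = shift c j ((pderiv k)^[m] Q) :=
  ((show Function.Semiconj (shift c j) (pderiv k) (pderiv k) from
    fun Q => (pderiv_shift c j k Q).symm).iterate_right m Q).symm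

theorem shift_eq_self_of_pderiv_eq_zero [CommSemiring R] [CharZero R] [NoZeroDivisors R] (c : R)
    {j : σ} {Q : MvPolynomial σ R} (hQ : pderiv j Q = 0) : shift c j Q = Q := by
  have hj : j ∉ Q.vars := fun h => pderiv_ne_zero_of_mem_vars h hQ
  have := hom_congr_vars (f₁ := (shift c j : MvPolynomial σ R →+* MvPolynomial σ R))
    (f₂ := RingHom.id _) (p₁ := Q) (p₂ := Q) (by ext; simp [shift])
    (fun k hk _ => by simp [shift_X, show k ≠ j by rintro rfl; exact hj hk]) rfl
  exact this

theorem shift_of_pderiv_pderiv_eq_zero [CommRing R] [CharZero R] [NoZeroDivisors R] (c : R)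
    {j : σ} {Q : MvPolynomial σ R} (hQ : pderiv j (pderiv j Q) = 0) :
    shift c j Q = Q + C c * pderiv j Q := by
  -- `Q` is affine in `ξ_j`: its slope `∂_j Q` and its constant term do not depend on `ξ_j`.
  have hconst : pderiv j (Q - X j * pderiv j Q) = 0 := by
    rw [map_sub, pderiv_mul, pderiv_X_self, hQ, one_mul, mul_zero, add_zero, sub_self]
  calc shift c j Q = shift c j (X j * pderiv j Q + (Q - X j * pderiv j Q)) := by
        rw [add_sub_cancel]
    _ = (X j + C c) * pderiv j Q + (Q - X j * pderiv j Q) := by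
        rw [map_add, map_mul, shift_X, if_pos rfl, shift_eq_self_of_pderiv_eq_zero c hQ,
          shift_eq_self_of_pderiv_eq_zero c hconst]
    _ = Q + C c * pderiv j Q := by ring

end Shift

end Polynomial

section Multiplication

/-- Multiplication of test functions by a smooth function. -/
def mulTest (m : Rn n → ℂ) (hm : ContDiff ℝ (⊤ : ℕ∞) m) : Module.End ℂ 𝓓(Ω, ℂ) where
  toFun f := ⟨fun x => m x * f x, hm.mul f.contDiff, f.hasCompactSupport.mul_left,
    tsupport_mul_subset_right.trans f.tsupport_subset⟩
  map_add' f g := by ext x; exact mul_add _ _ _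
  map_smul' c f := by ext x; exact mul_left_comm _ _ _

theorem mulTest_apply (m : Rn n → ℂ) (hm : ContDiff ℝ (⊤ : ℕ∞) m) (f : 𝓓(Ω, ℂ)) (x : Rn n) :
    mulTest m hm f x = m x * f x := rfl

theorem testD_mulTest_apply (m : Rn n → ℂ) (hm : ContDiff ℝ (⊤ : ℕ∞) m) (f : 𝓓(Ω, ℂ)) (j : Fin n)
    (x : Rn n) : testD j (mulTest m hm f) x = m x * testD j f x + D j m x * f x := by
  change -I * fderiv ℝ (fun x => m x * f x) x _ = _
  rw [fderiv_fun_mul (hm.differentiable (by simp) x) (differentiable_testFunction f x)]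
  simp only [testD_apply, D, add_apply, smul_apply, smul_eq_mul]
  ring

theorem contDiff_coord (j : Fin n) : ContDiff ℝ (⊤ : ℕ∞) fun x : Rn n => (x j : ℂ) :=
  Complex.ofRealCLM.contDiff.comp (EuclideanSpace.proj (𝕜 := ℝ) j).contDiff

theorem hasFDerivAt_coord (j : Fin n) (x : Rn n) :
    HasFDerivAt (fun x : Rn n => (x j : ℂ))
      (Complex.ofRealCLM.comp (EuclideanSpace.proj j : Rn n →L[ℝ] ℝ)) x :=
  (Complex.ofRealCLM.comp (EuclideanSpace.proj j : Rn n →L[ℝ] ℝ)).hasFDerivAt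

theorem D_coord (j k : Fin n) (x : Rn n) :
    D k (fun x => (x j : ℂ)) x = if k = j then -I else 0 := by
  rw [D, (hasFDerivAt_coord j x).fderiv]
  rcases eq_or_ne k j with rfl | h
  · simp
  · simp [h, h.symm]

theorem contDiff_exp_coord (τ : ℂ) (j : Fin n) :
    ContDiff ℝ (⊤ : ℕ∞) fun x : Rn n => Complex.exp (τ * x j) :=
  (contDiff_const.mul (contDiff_coord j)).cexp

theorem D_exp_coord (τ : ℂ) (j k : Fin n) (x : Rn n) :
    D k (fun x => Complex.exp (τ * x j)) x =
      (if k = j then -(I * τ) else 0) * Complex.exp (τ * x j) := by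
  rw [D, ((hasFDerivAt_coord j x).const_mul τ).cexp.fderiv]
  split_ifs with h
  · simp only [h, smul_apply, ContinuousLinearMap.comp_apply, PiLp.proj_apply,
      PiLp.single_eq_same, Complex.ofRealCLM_apply, Complex.ofReal_one, smul_eq_mul, mul_one]
    ring
  · simp [Ne.symm h]

/-- Multiplication of test functions by the coordinate `x_j`. -/
def mulCoord (j : Fin n) : Module.End ℂ 𝓓(Ω, ℂ) := mulTest _ (contDiff_coord j)

/-- Multiplication of test functions by `exp (τ x_j)`. -/
def mulExp (τ : ℂ) (j : Fin n) : Module.End ℂ 𝓓(Ω, ℂ) := mulTest _ (contDiff_exp_coord τ j)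

theorem testD_mulCoord (j k : Fin n) (f : 𝓓(Ω, ℂ)) :
    testD k (mulCoord j f) = mulCoord j (testD k f) - (if k = j then I else 0) • f := by
  ext x
  change testD k (mulTest _ (contDiff_coord j) f) x = x j * testD k f x - _ * f x
  rw [testD_mulTest_apply, D_coord]
  split_ifs <;> simp [sub_eq_add_neg]

theorem testD_mulExp (τ : ℂ) (j k : Fin n) (f : 𝓓(Ω, ℂ)) :
    testD k (mulExp τ j f) =
      mulExp τ j (testD k f) - (if k = j then I * τ else 0) • mulExp τ j f := by
  ext x
  change testD k (mulTest _ (contDiff_exp_coord τ j) f) x =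
    Complex.exp (τ * x j) * testD k f x - _ * (Complex.exp (τ * x j) * f x)
  rw [testD_mulTest_apply, D_exp_coord]
  split_ifs
  · ring
  · ring

theorem polyOp_mulCoord (Q : MvPolynomial (Fin n) ℂ) (j : Fin n) (f : 𝓓(Ω, ℂ)) :
    polyOp Q (mulCoord j f) = mulCoord j (polyOp Q f) - I • polyOp (pderiv j Q) f := by
  induction Q using MvPolynomial.induction_on generalizing f with
  | C a => simp
  | add p q hp hq => simp only [LinearMap.add_apply, map_add, hp, hq, smul_add]; abel
  | mul_X p k hp =>
    rw [polyOp_mul, polyOp_X, testD_mulCoord, map_sub, hp, polyOp_mul, polyOp_X, pderiv_mul,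
      polyOp_add, polyOp_mul, polyOp_X, polyOp_mul, pderiv_X, map_smul, smul_add, sub_sub]
    congr 2
    rcases eq_or_ne k j with rfl | h
    · simp
    · simp [h]

theorem polyOp_shift_mulExp (Q : MvPolynomial (Fin n) ℂ) (τ : ℂ) (j : Fin n) (f : 𝓓(Ω, ℂ)) :
    polyOp (shift (I * τ) j Q) (mulExp τ j f) = mulExp τ j (polyOp Q f) := by
  induction Q using MvPolynomial.induction_on generalizing f with
  | C a => simp [shift, algebraMap_eq]
  | add p q hp hq => simp only [LinearMap.add_apply, map_add, hp, hq]
  | mul_X p k hp =>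
    rw [map_mul, polyOp_mul, shift_X, polyOp_add, polyOp_X, polyOp_C, testD_mulExp, sub_add_cancel,
      hp, polyOp_mul, polyOp_X]

end Multiplication

section Hormander

variable {R : ℝ}

theorem norm_mulCoord_le {j : Fin n} (hΩ : ∀ x ∈ Ω, |x j| ≤ R) (f : 𝓓(Ω, ℂ)) :
    ‖toL2 (mulCoord j f)‖ ≤ R * ‖toL2 f‖ := by
  refine Lp.norm_le_mul_norm_of_ae_le_mul ?_
  filter_upwards [coeFn_toL2 f, coeFn_toL2 (mulCoord j f)] with x hf hjf
  rw [hf, hjf, mulCoord, mulTest_apply, norm_mul]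
  by_cases hx : f x = 0
  · simp [hx]
  · gcongr
    simpa using hΩ x (f.tsupport_subset (subset_tsupport _ hx))

theorem smul_polyOp_pderiv_eq (Q : MvPolynomial (Fin n) ℂ) (j : Fin n) (f : 𝓓(Ω, ℂ)) :
    I • toL2 (polyOp (pderiv j Q) f) =
      toL2 (mulCoord j (polyOp Q f)) - toL2 (polyOp Q (mulCoord j f)) := by
  rw [polyOp_mulCoord, map_sub, map_smul, sub_sub_cancel]

theorem inner_polyOp_pderiv_polyOp_mulCoord (Q : MvPolynomial (Fin n) ℂ) (j : Fin n)
    (f : 𝓓(Ω, ℂ)) :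
    ⟪toL2 (polyOp (pderiv j Q) f), toL2 (polyOp Q (mulCoord j f))⟫_ℂ =
      ⟪toL2 (polyOp (map conj Q) f), toL2 (mulCoord j (polyOp (map conj (pderiv j Q)) f)) -
        I • toL2 (polyOp (map conj (pderiv j (pderiv j Q))) f)⟫_ℂ := by
  have hadj := inner_polyOp (map conj Q) (polyOp (pderiv j Q) f) (mulCoord j f)
  rw [map_conj_map_conj] at hadj
  rw [← hadj, polyOp_polyOp_comm, inner_polyOp, polyOp_mulCoord, map_sub, map_smul, pderiv_map]

theorem norm_sq_polyOp_pderiv_le {j : Fin n} (hΩ : ∀ x ∈ Ω, |x j| ≤ R)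
    (Q : MvPolynomial (Fin n) ℂ) (f : 𝓓(Ω, ℂ)) :
    ‖toL2 (polyOp (pderiv j Q) f)‖ ^ 2 ≤ ‖toL2 (polyOp Q f)‖ *
      (2 * R * ‖toL2 (polyOp (pderiv j Q) f)‖ + ‖toL2 (polyOp (pderiv j (pderiv j Q)) f)‖) := by
  have hcoord := norm_mulCoord_le hΩ (polyOp Q f)
  have hright : ‖toL2 (mulCoord j (polyOp (map conj (pderiv j Q)) f)) -
      I • toL2 (polyOp (map conj (pderiv j (pderiv j Q))) f)‖ ≤
      R * ‖toL2 (polyOp (pderiv j Q) f)‖ + ‖toL2 (polyOp (pderiv j (pderiv j Q)) f)‖ := by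
    refine (norm_sub_le _ _).trans (add_le_add ?_ ?_)
    · exact (norm_mulCoord_le hΩ _).trans_eq (by rw [norm_polyOp_map_conj])
    · rw [norm_smul, Complex.norm_I, one_mul, norm_polyOp_map_conj]
  calc ‖toL2 (polyOp (pderiv j Q) f)‖ ^ 2
      = ‖⟪toL2 (polyOp (pderiv j Q) f), I • toL2 (polyOp (pderiv j Q) f)⟫_ℂ‖ := by
        simp [inner_smul_right, inner_self_eq_norm_sq_to_K]
    _ ≤ ‖toL2 (polyOp (pderiv j Q) f)‖ * (R * ‖toL2 (polyOp Q f)‖) +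
        ‖toL2 (polyOp (map conj Q) f)‖ * (R * ‖toL2 (polyOp (pderiv j Q) f)‖ +
          ‖toL2 (polyOp (pderiv j (pderiv j Q)) f)‖) := by
        rw [smul_polyOp_pderiv_eq, inner_sub_right, inner_polyOp_pderiv_polyOp_mulCoord]
        refine (norm_sub_le _ _).trans (add_le_add ?_ ?_)
        · exact (norm_inner_le_norm _ _).trans (by gcongr)
        · exact (norm_inner_le_norm _ _).trans (by gcongr)
    _ = _ := by rw [norm_polyOp_map_conj]; ring

theorem norm_polyOp_pderiv_le (hR : 0 ≤ R) {j : Fin n} (hΩ : ∀ x ∈ Ω, |x j| ≤ R) {m : ℕ}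
    {Q : MvPolynomial (Fin n) ℂ} (hQ : (pderiv j)^[m] Q = 0) (f : 𝓓(Ω, ℂ)) :
    ‖toL2 (polyOp (pderiv j Q) f)‖ ≤ 2 * m * R * ‖toL2 (polyOp Q f)‖ := by
  induction m generalizing Q with
  | zero => simp [show Q = 0 from hQ]
  | succ m ih =>
    have hsecond := ih (Q := pderiv j Q) hQ
    have hsq := norm_sq_polyOp_pderiv_le hΩ Q f
    generalize ‖toL2 (polyOp (pderiv j (pderiv j Q)) f)‖ = r at hsecond hsq
    have hp := norm_nonneg (toL2 (polyOp (pderiv j Q) f))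
    have hq := norm_nonneg (toL2 (polyOp Q f))
    generalize ‖toL2 (polyOp (pderiv j Q) f)‖ = p at *
    generalize ‖toL2 (polyOp Q f)‖ = q at *
    rcases hp.eq_or_lt with rfl | hp
    · positivity
    · push_cast
      refine le_of_mul_le_mul_left ?_ hp
      nlinarith [mul_le_mul_of_nonneg_left hsecond hq]

theorem exists_mul_norm_le_norm_polyOp (hR : 0 ≤ R) (hΩ : ∀ x ∈ Ω, ∀ j, |x j| ≤ R)
    {Q : MvPolynomial (Fin n) ℂ} (hQ : Q ≠ 0) :
    ∃ c > 0, ∀ f : 𝓓(Ω, ℂ), c * ‖toL2 f‖ ≤ ‖toL2 (polyOp Q f)‖ := by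
  induction hd : Q.totalDegree using Nat.strong_induction_on generalizing Q with
  | _ d ih =>
  by_cases h0 : Q.totalDegree = 0
  · obtain ⟨a, rfl⟩ : ∃ a, Q = C a := ⟨_, totalDegree_eq_zero_iff_eq_C.1 h0⟩
    refine ⟨‖a‖, norm_pos_iff.2 fun ha => hQ (by rw [ha, C_0]), fun f => ?_⟩
    rw [polyOp_C, map_smul, norm_smul]
  · obtain ⟨j, hj⟩ := exists_pderiv_ne_zero h0
    obtain ⟨c, hc, hderiv⟩ := ih _ (hd ▸ totalDegree_pderiv_lt h0 j) hj rfl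
    have hK : 0 < 2 * ((Q.totalDegree + 1 : ℕ) : ℝ) * R + 1 := by positivity
    refine ⟨c / (2 * ((Q.totalDegree + 1 : ℕ) : ℝ) * R + 1), by positivity, fun f => ?_⟩
    rw [div_mul_eq_mul_div, div_le_iff₀ hK]
    calc c * ‖toL2 f‖ ≤ ‖toL2 (polyOp (pderiv j Q) f)‖ := hderiv f
      _ ≤ 2 * (Q.totalDegree + 1 : ℕ) * R * ‖toL2 (polyOp Q f)‖ :=
          norm_polyOp_pderiv_le hR (fun x hx => hΩ x hx j)
            (iterate_pderiv_eq_zero j Q.totalDegree.lt_succ_self) f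
      _ ≤ ‖toL2 (polyOp Q f)‖ * (2 * (Q.totalDegree + 1 : ℕ) * R + 1) := by
          linarith [norm_nonneg (toL2 (polyOp Q f))]

theorem exists_norm_polyOp_polyDeriv_le (hR : 0 ≤ R) (hΩ : ∀ x ∈ Ω, ∀ j, |x j| ≤ R)
    (P : MvPolynomial (Fin n) ℝ) (α : Fin n → ℕ) : ∃ K, 0 ≤ K ∧ ∀ f : 𝓓(Ω, ℂ),
      ‖toL2 (polyOp (cx (polyDeriv α P)) f)‖ ≤ K * ‖toL2 (polyOp (cx P) f)‖ := by
  unfold polyDeriv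
  induction List.finRange n with
  | nil => exact ⟨1, zero_le_one, fun f => by simp⟩
  | cons j l ihl =>
    rw [List.foldr_cons]
    induction α j with
    | zero => exact ihl
    | succ k ihk =>
      obtain ⟨K, hK, hbound⟩ := ihk
      rw [Function.iterate_succ_apply']
      generalize (pderiv j)^[k] (List.foldr (fun j Q => (pderiv j)^[α j] Q) P l) = Q at hbound ⊢
      refine ⟨2 * ((cx Q).totalDegree + 1 : ℕ) * R * K, by positivity, fun f => ?_⟩
      have hderiv := norm_polyOp_pderiv_le hR (fun x hx => hΩ x hx j)
        (iterate_pderiv_eq_zero j (cx Q).totalDegree.lt_succ_self) f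
      rw [pderiv_map] at hderiv
      refine hderiv.trans ?_
      rw [mul_assoc _ K]
      gcongr
      exact hbound f

end Hormander

section Carleman

variable {R : ℝ}

theorem exists_norm_polyOp_shift_iterate_pderiv_le (hR : 0 ≤ R) {j : Fin n}
    (hΩ : ∀ x ∈ Ω, |x j| ≤ R) (Q : MvPolynomial (Fin n) ℂ) (k : ℕ) :
    ∃ K > 0, ∀ (c : ℂ) (f : 𝓓(Ω, ℂ)), ‖toL2 (polyOp (shift c j ((pderiv j)^[k] Q)) f)‖ ≤
      K * ‖toL2 (polyOp (shift c j Q) f)‖ := by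
  induction k with
  | zero => exact ⟨1, one_pos, fun c f => by simp⟩
  | succ k ih =>
    obtain ⟨K, hK, hbound⟩ := ih
    refine ⟨(2 * (((pderiv j)^[k] Q).totalDegree + 1 : ℕ) * R + 1) * K, by positivity,
      fun c f => ?_⟩
    rw [Function.iterate_succ_apply', ← pderiv_shift, mul_assoc]
    have hzero := iterate_pderiv_eq_zero j ((pderiv j)^[k] Q).totalDegree.lt_succ_self
    refine (norm_polyOp_pderiv_le hR hΩ (by rw [iterate_pderiv_shift, hzero, map_zero]) f).trans ?_
    exact mul_le_mul (by linarith) (hbound c f) (norm_nonneg _) (by positivity)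

theorem abs_mul_norm_le_norm_polyOp_shift {S : MvPolynomial (Fin n) ℝ} {j : Fin n}
    (hS : pderiv j (pderiv j S) = 0) (τ : ℝ) (f : 𝓓(Ω, ℂ)) :
    |τ| * ‖toL2 (polyOp (cx (pderiv j S)) f)‖ ≤
      ‖toL2 (polyOp (shift (I * τ) j (cx S)) f)‖ := by
  -- `S(D) f` and `iτ (∂_j S)(D) f` are orthogonal for the real scalar product.
  have hshift : toL2 (polyOp (shift (I * τ) j (cx S)) f) =
      toL2 (polyOp (cx S) f) + (I * τ) • toL2 (polyOp (cx (pderiv j S)) f) := by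
    rw [shift_of_pderiv_pderiv_eq_zero _ (by rw [pderiv_map, pderiv_map, hS, map_zero]),
      polyOp_add, map_add, polyOp_mul, polyOp_C, map_smul, pderiv_map]
  have hsymm : conj ⟪toL2 (polyOp (cx S) f), toL2 (polyOp (cx (pderiv j S)) f)⟫_ℂ =
      ⟪toL2 (polyOp (cx S) f), toL2 (polyOp (cx (pderiv j S)) f)⟫_ℂ := by
    rw [inner_conj_symm, inner_polyOp_cx, inner_polyOp_cx, polyOp_polyOp_comm]
  have horth : RCLike.re ⟪toL2 (polyOp (cx S) f),
      (I * τ) • toL2 (polyOp (cx (pderiv j S)) f)⟫_ℂ = 0 := by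
    rw [inner_smul_right]
    simp [Complex.conj_eq_iff_im.1 hsymm]
  rw [hshift]
  refine (abs_le_of_sq_le_sq' ?_ (norm_nonneg _)).2
  rw [norm_add_sq (𝕜 := ℂ), horth, norm_smul]
  simp

theorem exists_carleman (hR : 0 ≤ R) (hΩ : ∀ x ∈ Ω, ∀ j, |x j| ≤ R) {P : MvPolynomial (Fin n) ℝ}
    (hP : P.totalDegree ≠ 0) : ∃ j : Fin n, ∃ c > 0, ∀ (τ : ℝ) (f : 𝓓(Ω, ℂ)),
      c * |τ| * ‖toL2 (mulExp τ j f)‖ ≤ ‖toL2 (mulExp τ j (polyOp (cx P) f))‖ := by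
  obtain ⟨j, hj⟩ := exists_pderiv_ne_zero hP
  obtain ⟨k, hk, hk'⟩ := exists_iterate_pderiv_ne_zero hj
  obtain ⟨c, hc, hlower⟩ := exists_mul_norm_le_norm_polyOp hR hΩ
    ((map_ne_zero_iff _ (map_injective _ Complex.ofRealHom.injective)).2 hk)
  obtain ⟨K, hK, hupper⟩ :=
    exists_norm_polyOp_shift_iterate_pderiv_le hR (fun x hx => hΩ x hx j) (cx P) k
  refine ⟨j, c / K, by positivity, fun τ f => ?_⟩
  rw [div_mul_eq_mul_div, div_mul_eq_mul_div, div_le_iff₀' hK]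
  calc c * |τ| * ‖toL2 (mulExp τ j f)‖ = |τ| * (c * ‖toL2 (mulExp τ j f)‖) := by ring
    _ ≤ |τ| * ‖toL2 (polyOp (cx (pderiv j ((pderiv j)^[k] P))) (mulExp τ j f))‖ := by
        gcongr
        exact hlower _
    _ ≤ ‖toL2 (polyOp (shift (I * τ) j (cx ((pderiv j)^[k] P))) (mulExp τ j f))‖ :=
        abs_mul_norm_le_norm_polyOp_shift hk' τ _
    _ ≤ K * ‖toL2 (mulExp τ j (polyOp (cx P) f))‖ := by
        rw [cx_iterate_pderiv, ← polyOp_shift_mulExp]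
        exact hupper _ _

end Carleman

/-! ### Nonpositive index of self-adjoint operators -/

section Index

variable {H : Type*} [NormedAddCommGroup H] [InnerProductSpace ℂ H]

/-- The quadratic form `u ↦ Re ⟪T u, u⟫` of `T` is nonpositive on `W`. -/
def NonposOn (T : H →L[ℂ] H) (W : Submodule ℂ H) : Prop :=
  ∀ u ∈ W, T.reApplyInnerSelf u ≤ 0

/-- The supremum of the dimensions of the subspaces on which the quadratic form of `T` is
nonpositive: the Morse index of `T` if `T` is self-adjoint and invertible. -/
def nonposIndex (T : H →L[ℂ] H) : Cardinal :=
  ⨆ W : {W : Submodule ℂ H // NonposOn T W}, Module.rank ℂ W.1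

/-- The quadratic form of `T` is coercive on the orthogonal complement of a finite dimensional
subspace, as in Gårding's inequality. -/
def FinitelyCoercive (T : H →L[ℂ] H) : Prop :=
  ∃ G : Submodule ℂ H, FiniteDimensional ℂ G ∧
    ∃ c > 0, ∀ u ∈ Gᗮ, c * ‖u‖ ^ 2 ≤ T.reApplyInnerSelf u

theorem NonposOn.rank_le_nonposIndex {T : H →L[ℂ] H} {W : Submodule ℂ H} (hW : NonposOn T W) :
    Module.rank ℂ W ≤ nonposIndex T :=
  le_ciSup (f := fun W : {W : Submodule ℂ H // NonposOn T W} => Module.rank ℂ W.1)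
    (Cardinal.bddAbove_of_small) ⟨W, hW⟩

theorem nonposIndex_le_rank {T : H →L[ℂ] H} {F : Submodule ℂ H} (L : H →ₗ[ℂ] F)
    {c : ℝ} (hc : 0 < c) (hL : ∀ u, L u = 0 → c * ‖u‖ ^ 2 ≤ T.reApplyInnerSelf u) :
    nonposIndex T ≤ Module.rank ℂ F := by
  refine ciSup_le' fun ⟨W, hW⟩ => LinearMap.rank_le_of_injective (L.comp W.subtype) ?_
  rw [← LinearMap.ker_eq_bot, LinearMap.ker_eq_bot']
  intro u hu
  have hnorm : ‖(u : H)‖ ^ 2 ≤ 0 :=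
    nonpos_of_mul_nonpos_right ((hL u hu).trans (hW u u.2)) hc
  exact Subtype.ext (norm_eq_zero.1 (pow_eq_zero_iff two_ne_zero |>.1
    (le_antisymm hnorm (sq_nonneg _))))

theorem abs_reApplyInnerSelf_sub_le (T T' : H →L[ℂ] H) (u : H) :
    |T'.reApplyInnerSelf u - T.reApplyInnerSelf u| ≤ ‖T' - T‖ * ‖u‖ ^ 2 := by
  rw [ContinuousLinearMap.reApplyInnerSelf_apply, ContinuousLinearMap.reApplyInnerSelf_apply,
    ← map_sub, ← inner_sub_left, ← sub_apply]
  calc |RCLike.re ⟪(T' - T) u, u⟫_ℂ| ≤ ‖(T' - T) u‖ * ‖u‖ :=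
        (RCLike.abs_re_le_norm _).trans (norm_inner_le_norm _ _)
    _ ≤ ‖T' - T‖ * ‖u‖ * ‖u‖ := by gcongr; exact (T' - T).le_opNorm u
    _ = ‖T' - T‖ * ‖u‖ ^ 2 := by ring

theorem FinitelyCoercive.exists_nonposIndex_le {T : H →L[ℂ] H} (hT : FinitelyCoercive T) :
    ∃ N : ℕ, ∀ᶠ T' in 𝓝 T, nonposIndex T' ≤ N := by
  obtain ⟨G, hG, c, hc, hcoer⟩ := hT
  refine ⟨Module.finrank ℂ G, ?_⟩
  filter_upwards [Metric.ball_mem_nhds T (half_pos hc)] with T' hT'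
  rw [Metric.mem_ball, dist_eq_norm] at hT'
  rw [Module.finrank_eq_rank]
  refine nonposIndex_le_rank G.orthogonalProjectionOnto.toLinearMap (half_pos hc) fun u hu => ?_
  have hle := hcoer u ((Submodule.orthogonalProjectionOnto_eq_zero_iff).1 hu)
  have hdiff := (abs_le.1 (abs_reApplyInnerSelf_sub_le T T' u)).1
  nlinarith [sq_nonneg ‖u‖]

theorem exists_nonposIndex_le_of_isCompact {X : Type*} [TopologicalSpace X] {T : X → H →L[ℂ] H}
    {K : Set X} (hK : IsCompact K) (hT : ContinuousOn T K)
    (hcoer : ∀ x ∈ K, FinitelyCoercive (T x)) : ∃ N : ℕ, ∀ x ∈ K, nonposIndex (T x) ≤ N := by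
  refine hK.induction_on ⟨0, by simp⟩ (fun s t hst ⟨N, hN⟩ => ⟨N, fun x hx => hN x (hst hx)⟩)
    ?_ fun x hx => ?_
  · rintro s t ⟨N, hN⟩ ⟨M, hM⟩
    refine ⟨max N M, fun x hx => ?_⟩
    rcases hx with hx | hx
    · exact (hN x hx).trans (by exact_mod_cast le_max_left N M)
    · exact (hM x hx).trans (by exact_mod_cast le_max_right N M)
  · obtain ⟨N, hN⟩ := (hcoer x hx).exists_nonposIndex_le
    exact ⟨_, (hT x hx).eventually hN, N, fun _ h => h⟩

theorem isClosed_map_of_coercive [CompleteSpace H] {T : H →L[ℂ] H} {W : Submodule ℂ H}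
    (hW : IsClosed (W : Set H)) {c : ℝ} (hc : 0 < c)
    (h : ∀ u ∈ W, c * ‖u‖ ^ 2 ≤ T.reApplyInnerSelf u) :
    IsClosed (W.map T.toLinearMap : Set H) := by
  have : CompleteSpace W := hW.completeSpace_coe
  have hbound : ∀ u : W, ‖u‖ ≤ (c⁻¹).toNNReal * ‖(T ∘L W.subtypeL) u‖ := by
    intro u
    have hle : c * ‖u‖ * ‖u‖ ≤ ‖T u‖ * ‖u‖ := by
      calc c * ‖u‖ * ‖u‖ = c * ‖(u : H)‖ ^ 2 := by rw [Submodule.coe_norm]; ring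
        _ ≤ ‖⟪T u, u⟫_ℂ‖ := (h u u.2).trans (RCLike.re_le_norm _)
        _ ≤ ‖T u‖ * ‖u‖ := norm_inner_le_norm _ _
    rcases (norm_nonneg u).eq_or_lt with hu | hu
    · rw [← hu]
      positivity
    · rw [Real.coe_toNNReal _ (inv_nonneg.2 hc.le), ← div_eq_inv_mul, le_div_iff₀ hc, mul_comm]
      exact le_of_mul_le_mul_right hle hu
  have hclosed := ((T ∘L W.subtypeL).antilipschitz_of_bound hbound).isClosed_range
    (T ∘L W.subtypeL).uniformContinuous
  convert hclosed
  ext; simp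

variable [CompleteSpace H]

theorem FinitelyCoercive.isClosed_range {T : H →L[ℂ] H} (hT : FinitelyCoercive T) :
    IsClosed (LinearMap.range T.toLinearMap : Set H) := by
  obtain ⟨G, hG, c, hc, hcoer⟩ := hT
  rw [LinearMap.range_eq_map, ← Submodule.sup_orthogonal_of_hasOrthogonalProjection (K := G),
    Submodule.map_sup, sup_comm]
  exact Submodule.isClosed_sup_finiteDimensional _ _
    (isClosed_map_of_coercive G.isClosed_orthogonal hc hcoer)

theorem FinitelyCoercive.isUnit {T : H →L[ℂ] H} (hT : FinitelyCoercive T)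
    (hself : IsSelfAdjoint T) (hker : T.ker = ⊥) : IsUnit T := by
  rw [ContinuousLinearMap.isUnit_iff_bijective]
  refine ⟨LinearMap.ker_eq_bot.1 hker, LinearMap.range_eq_top.1 ?_⟩
  rw [← hT.isClosed_range.submodule_topologicalClosure_eq,
    Submodule.topologicalClosure_eq_top_iff, ContinuousLinearMap.orthogonal_range,
    hself.adjoint_eq, hker]

theorem exists_sign_operator {T : H →L[ℂ] H} (hself : IsSelfAdjoint T) (hunit : IsUnit T) :
    ∃ S : H →L[ℂ] H, IsSelfAdjoint S ∧ S * S = 1 ∧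
      ∃ c > 0, algebraMap ℝ (H →L[ℂ] H) c ≤ S * T := by
  have hzero : (0 : ℝ) ∉ spectrum ℝ T := spectrum.zero_notMem ℝ hunit
  let sgn : ℝ → ℝ := fun x => SignType.sign x
  have hcont : ContinuousOn sgn (spectrum ℝ T) := fun x hx =>
    (ContinuousAt.comp (g := ((↑) : SignType → ℝ)) continuous_of_discreteTopology.continuousAt
      (continuousAt_sign_of_ne_zero fun h => hzero (h ▸ hx))).continuousWithinAt
  obtain ⟨c, hc, hball⟩ := Metric.isOpen_iff.1
    (spectrum.isClosed (𝕜 := ℝ) T).isOpen_compl 0 hzero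
  refine ⟨cfc sgn T, cfc_predicate _ _, ?_, c, hc, ?_⟩
  · rw [← cfc_mul sgn sgn T hcont hcont, ← cfc_one ℝ T]
    refine cfc_congr fun x hx => ?_
    rcases lt_trichotomy x 0 with h | rfl | h
    · simp [sgn, h]
    · exact absurd hx hzero
    · simp [sgn, h]
  · have habs : cfc sgn T * T = cfc (fun x => sgn x * x) T := by
      rw [cfc_mul sgn (fun x => x) T hcont continuousOn_id, cfc_id' ℝ T]
    rw [habs]
    refine algebraMap_le_cfc _ c T (fun x hx => ?_) (hcont.mul continuousOn_id)
    rw [sign_mul_self]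
    by_contra! hlt
    exact hball (by simpa using hlt) hx

theorem exists_spectral_splitting {T : H →L[ℂ] H} (hself : IsSelfAdjoint T) (hunit : IsUnit T) :
    ∃ S : H →L[ℂ] H, S * S = 1 ∧ ∃ c > 0,
      (∀ u, S u = u → c * ‖u‖ ^ 2 ≤ T.reApplyInnerSelf u) ∧
      ∀ u, S u = -u → T.reApplyInnerSelf u ≤ -(c * ‖u‖ ^ 2) := by
  obtain ⟨S, hS, hSS, c, hc, hle⟩ := exists_sign_operator hself hunit
  have hform : ∀ u, c * ‖u‖ ^ 2 ≤ RCLike.re ⟪T u, S u⟫_ℂ := by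
    intro u
    have h := ((ContinuousLinearMap.le_def _ _).1 hle).re_inner_nonneg_left u
    rw [sub_apply, inner_sub_left, map_sub, sub_nonneg, Algebra.algebraMap_eq_smul_one,
      smul_apply, one_apply_eq_self, RCLike.real_smul_eq_coe_smul (K := ℂ), inner_smul_left,
      mul_apply_eq_comp, hS.isSymmetric.apply_clm] at h
    simpa [inner_self_eq_norm_sq_to_K, ← Complex.ofReal_pow] using h
  refine ⟨S, hSS, c, hc, fun u hu => ?_, fun u hu => ?_⟩
  · simpa only [hu, ContinuousLinearMap.reApplyInnerSelf_apply] using hform u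
  · have h := hform u
    rw [hu, inner_neg_right, map_neg] at h
    exact le_neg_of_le_neg h

theorem eventually_nonposIndex_eq {T : H →L[ℂ] H} (hself : IsSelfAdjoint T) (hunit : IsUnit T) :
    ∀ᶠ T' in 𝓝 T, nonposIndex T' = nonposIndex T := by
  obtain ⟨S, hSS, c, hc, hpos, hneg⟩ := exists_spectral_splitting hself hunit
  let E : Submodule ℂ H := LinearMap.ker (S + 1).toLinearMap
  have hE : ∀ u, u - S u ∈ E := fun u => by
    have hSSu : S (S u) = u := congrArg (· u) hSS
    change S (u - S u) + (u - S u) = 0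
    rw [map_sub, hSSu]
    abel
  have hindex : ∀ᶠ T' in 𝓝 T, nonposIndex T' = Module.rank ℂ E := by
    filter_upwards [Metric.ball_mem_nhds T hc] with T' hT'
    rw [Metric.mem_ball, dist_eq_norm] at hT'
    refine le_antisymm ?_ (NonposOn.rank_le_nonposIndex fun u hu => ?_)
    · refine nonposIndex_le_rank ((1 - S).toLinearMap.codRestrict E hE)
        (sub_pos.2 hT') fun u hu => ?_
      have hSu : S u = u := (sub_eq_zero.1 (congrArg Subtype.val hu)).symm
      have hdiff := (abs_le.1 (abs_reApplyInnerSelf_sub_le T T' u)).1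
      linarith [hpos u hSu]
    · have hSu : S u = -u := eq_neg_of_add_eq_zero_left hu
      have hdiff := (abs_le.1 (abs_reApplyInnerSelf_sub_le T T' u)).2
      nlinarith [hneg u hSu, sq_nonneg ‖u‖]
  filter_upwards [hindex] with T' hT'
  rw [hT', hindex.self_of_nhds]

theorem nonposIndex_eq_of_isPreconnected {X : Type*} [TopologicalSpace X] {T : X → H →L[ℂ] H}
    {s : Set X} (hs : IsPreconnected s) (hT : ContinuousOn T s)
    (hself : ∀ x ∈ s, IsSelfAdjoint (T x)) (hunit : ∀ x ∈ s, IsUnit (T x)) {x y : X}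
    (hx : x ∈ s) (hy : y ∈ s) : nonposIndex (T x) = nonposIndex (T y) := by
  refine hs.induction₂ (fun x y => nonposIndex (T x) = nonposIndex (T y)) (fun x hx => ?_)
    (fun _ _ _ _ _ _ => Eq.trans) (fun _ _ _ _ => Eq.symm) hx hy
  filter_upwards [(hT x hx).eventually (eventually_nonposIndex_eq (hself x hx) (hunit x hx))]
    with y hy
  exact hy.symm

theorem exists_nonposIndex_le_of_finite_singular {T : ℝ → H →L[ℂ] H} (hT : Continuous T)
    (hself : ∀ t, IsSelfAdjoint (T t)) (hcoer : ∀ t, FinitelyCoercive (T t))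
    (hfin : {t | (T t).ker ≠ ⊥}.Finite) : ∃ N : ℕ, ∀ t, nonposIndex (T t) ≤ N := by
  obtain ⟨R, hR⟩ := hfin.isBounded.subset_ball 0
  have hunit : ∀ t, R ≤ |t| → IsUnit (T t) := fun t ht =>
    (hcoer t).isUnit (hself t) (by
      by_contra h
      exact ht.not_gt (by simpa using hR h))
  obtain ⟨N, hN⟩ := exists_nonposIndex_le_of_isCompact (isCompact_Icc (a := -|R|) (b := |R|))
    hT.continuousOn fun t _ => hcoer t
  refine ⟨N, fun t => ?_⟩
  rcases le_total t (-|R|) with ht | ht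
  · rw [nonposIndex_eq_of_isPreconnected isPreconnected_Iic hT.continuousOn
      (fun t _ => hself t) (fun s hs => hunit s ?_) (Set.mem_Iic.2 ht) Set.self_mem_Iic]
    · exact hN _ ⟨le_rfl, neg_le_self (abs_nonneg R)⟩
    · exact (le_abs_self R).trans ((le_neg.1 hs).trans (neg_le_abs s))
  rcases le_total t |R| with ht' | ht'
  · exact hN t ⟨ht, ht'⟩
  · rw [nonposIndex_eq_of_isPreconnected isPreconnected_Ici hT.continuousOn
      (fun t _ => hself t) (fun s hs => hunit s ?_) (Set.mem_Ici.2 ht') Set.self_mem_Ici]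
    · exact hN _ ⟨neg_le_self (abs_nonneg R), le_rfl⟩
    · exact (le_abs_self R).trans (hs.trans (le_abs_self s))

end Index

/-! ### Compactness -/

section Compactness

open scoped FourierTransform LineDeriv SchwartzMap

theorem exists_norm_inner_sq_le_of_isCompact {H : Type*} [NormedAddCommGroup H]
    [InnerProductSpace ℂ H] {K : Set H} (hK : IsCompact K) {δ : ℝ} (hδ : 0 < δ) :
    ∃ s : Finset H, ∀ k ∈ K, ∀ u,
      ‖⟪k, u⟫_ℂ‖ ^ 2 ≤ 2 * ∑ g ∈ s, ‖⟪g, u⟫_ℂ‖ ^ 2 + 2 * δ ^ 2 * ‖u‖ ^ 2 := by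
  obtain ⟨t, -, htfin, ht⟩ := hK.finite_cover_balls hδ
  refine ⟨htfin.toFinset, fun k hk u => ?_⟩
  obtain ⟨g, hg, hkg⟩ := Set.mem_iUnion₂.1 (ht hk)
  rw [Metric.mem_ball, dist_eq_norm] at hkg
  have hle : ‖⟪k, u⟫_ℂ‖ ≤ ‖⟪g, u⟫_ℂ‖ + δ * ‖u‖ := by
    calc ‖⟪k, u⟫_ℂ‖ = ‖⟪g, u⟫_ℂ + ⟪k - g, u⟫_ℂ‖ := by rw [← inner_add_left, add_sub_cancel]
      _ ≤ ‖⟪g, u⟫_ℂ‖ + ‖k - g‖ * ‖u‖ :=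
        (norm_add_le _ _).trans (add_le_add le_rfl (norm_inner_le_norm _ _))
      _ ≤ _ := by gcongr
  have hsum : ‖⟪g, u⟫_ℂ‖ ^ 2 ≤ ∑ g ∈ htfin.toFinset, ‖⟪g, u⟫_ℂ‖ ^ 2 :=
    Finset.single_le_sum (f := fun g => ‖⟪g, u⟫_ℂ‖ ^ 2) (fun _ _ => by positivity)
      (htfin.mem_toFinset.2 hg)
  calc ‖⟪k, u⟫_ℂ‖ ^ 2 ≤ (‖⟪g, u⟫_ℂ‖ + δ * ‖u‖) ^ 2 := by gcongr
    _ ≤ 2 * (‖⟪g, u⟫_ℂ‖ ^ 2 + (δ * ‖u‖) ^ 2) := add_sq_le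
    _ ≤ _ := by rw [mul_pow]; linarith

/-- Test functions as Schwartz functions. -/
def toSchwartz : 𝓓(Ω, ℂ) →ₗ[ℂ] 𝓢(Rn n, ℂ) where
  toFun f := f.hasCompactSupport.toSchwartzMap f.contDiff
  map_add' _ _ := rfl
  map_smul' _ _ := rfl

theorem toLp_toSchwartz (f : 𝓓(Ω, ℂ)) : (toSchwartz f).toLp 2 = toL2 f := rfl

theorem toSchwartz_testD (j : Fin n) (f : 𝓓(Ω, ℂ)) :
    toSchwartz (testD j f) = -I • ∂_{EuclideanSpace.single j (1 : ℝ)} (toSchwartz f) := rfl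

theorem fourier_testD (j : Fin n) (f : 𝓓(Ω, ℂ)) (ξ : Rn n) :
    𝓕 (toSchwartz (testD j f)) ξ = ((2 * Real.pi * ξ j : ℝ) : ℂ) * 𝓕 (toSchwartz f) ξ := by
  rw [toSchwartz_testD, FourierTransform.fourier_smul, SchwartzMap.fourier_lineDerivOp_eq,
    smul_apply, smul_apply, SchwartzMap.smulLeftCLM_apply_apply (by fun_prop)]
  simp only [EuclideanSpace.inner_single_right, smul_eq_mul, Complex.real_smul,
    Real.ringHom_apply, one_mul, Complex.ofReal_mul, Complex.ofReal_ofNat]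
  linear_combination (-2 * Real.pi * ξ j * 𝓕 (toSchwartz f) ξ) * Complex.I_sq

theorem fourier_polyOp (Q : MvPolynomial (Fin n) ℂ) (f : 𝓓(Ω, ℂ)) (ξ : Rn n) :
    𝓕 (toSchwartz (polyOp Q f)) ξ =
      eval (fun j => ((2 * Real.pi * ξ j : ℝ) : ℂ)) Q * 𝓕 (toSchwartz f) ξ := by
  induction Q using MvPolynomial.induction_on generalizing f with
  | C a =>
    rw [polyOp_C, map_smul, FourierTransform.fourier_smul, smul_apply, smul_eq_mul, eval_C]
  | add p q hp hq =>
    rw [polyOp_add, map_add, FourierTransform.fourier_add, add_apply, hp, hq, map_add, add_mul]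
  | mul_X p j hp =>
    rw [polyOp_mul, polyOp_X, hp, fourier_testD, map_mul, eval_X]
    ring

theorem norm_fourier_polyOp_cx_sq (P : MvPolynomial (Fin n) ℝ) (f : 𝓓(Ω, ℂ)) (ξ : Rn n) :
    ‖𝓕 (toSchwartz (polyOp (cx P) f)) ξ‖ ^ 2 =
      eval (fun j => ((2 * Real.pi) • ξ) j) P ^ 2 * ‖𝓕 (toSchwartz f) ξ‖ ^ 2 := by
  have hreal : eval (fun j => ((2 * Real.pi * ξ j : ℝ) : ℂ)) (cx P) =
      ((eval (fun j => ((2 * Real.pi) • ξ) j) P : ℝ) : ℂ) := by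
    rw [cx, eval_map]
    exact (eval₂_comp_left Complex.ofRealHom (RingHom.id ℝ) _ P).symm
  rw [fourier_polyOp, hreal, norm_mul, mul_pow, Complex.norm_real, Real.norm_eq_abs, sq_abs]

theorem integrable_norm_fourier_sq (f : 𝓓(Ω, ℂ)) :
    Integrable fun ξ => ‖𝓕 (toSchwartz f) ξ‖ ^ 2 :=
  ((𝓕 (toSchwartz f)).memLp 2).integrable_norm_pow two_ne_zero

theorem integral_norm_fourier_sq (f : 𝓓(Ω, ℂ)) :
    ∫ ξ, ‖𝓕 (toSchwartz f) ξ‖ ^ 2 = ‖toL2 f‖ ^ 2 := by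
  have h := SchwartzMap.norm_toLp' (f := 𝓕 (toSchwartz f)) (p := 2) (μ := volume)
    two_ne_zero ENNReal.ofNat_ne_top
  rw [SchwartzMap.norm_fourier_toL2_eq, toLp_toSchwartz] at h
  rw [h, ← Real.rpow_natCast, ← Real.rpow_mul (integral_nonneg fun _ => by positivity)]
  norm_num

theorem exists_abs_coord_le (hb : Bornology.IsBounded (Ω : Set (Rn n))) :
    ∃ R, 0 ≤ R ∧ ∀ x ∈ Ω, ∀ j, |x j| ≤ R := by
  obtain ⟨R, hR, hsub⟩ := hb.subset_closedBall_lt 0 0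
  exact ⟨R, hR.le, fun x hx j =>
    (PiLp.norm_apply_le x j).trans (mem_closedBall_zero_iff.1 (hsub hx))⟩

theorem exists_integral_weight_le (hb : Bornology.IsBounded (Ω : Set (Rn n)))
    (P : MvPolynomial (Fin n) ℝ) : ∃ K, 0 ≤ K ∧ ∀ f : 𝓓(Ω, ℂ),
      Integrable (fun ξ => weight P ((2 * Real.pi) • ξ) ^ 2 * ‖𝓕 (toSchwartz f) ξ‖ ^ 2) ∧
      ∫ ξ, weight P ((2 * Real.pi) • ξ) ^ 2 * ‖𝓕 (toSchwartz f) ξ‖ ^ 2 ≤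
        K * ‖toL2 (polyOp (cx P) f)‖ ^ 2 := by
  obtain ⟨R, hR, hΩ⟩ := exists_abs_coord_le hb
  choose K _ hle using exists_norm_polyOp_polyDeriv_le hR hΩ P
  let A := Fintype.piFinset fun _ : Fin n => Finset.range (P.totalDegree + 1)
  refine ⟨∑ α ∈ A, K α ^ 2, by positivity, fun f => ?_⟩
  have hweight : (fun ξ => weight P ((2 * Real.pi) • ξ) ^ 2 * ‖𝓕 (toSchwartz f) ξ‖ ^ 2) =
      fun ξ => ∑ α ∈ A, ‖𝓕 (toSchwartz (polyOp (cx (polyDeriv α P)) f)) ξ‖ ^ 2 := by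
    ext ξ
    rw [weight, Real.sq_sqrt (by positivity), Finset.sum_mul]
    exact Finset.sum_congr rfl fun α _ => (norm_fourier_polyOp_cx_sq _ f ξ).symm
  rw [hweight, integral_finsetSum _ fun α _ => integrable_norm_fourier_sq _, Finset.sum_mul]
  refine ⟨integrable_finsetSum _ fun α _ => integrable_norm_fourier_sq _,
    Finset.sum_le_sum fun α _ => ?_⟩
  rw [integral_norm_fourier_sq, ← mul_pow]
  exact pow_le_pow_left₀ (norm_nonneg _) (hle α f) 2

theorem exists_setIntegral_fourier_compl_le (hb : Bornology.IsBounded (Ω : Set (Rn n)))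
    {P : MvPolynomial (Fin n) ℝ} (hP : Tendsto (weight P) (cocompact (Rn n)) atTop) {η : ℝ}
    (hη : 0 < η) : ∃ r, ∀ f : 𝓓(Ω, ℂ),
      ∫ ξ in (Metric.closedBall 0 r)ᶜ, ‖𝓕 (toSchwartz f) ξ‖ ^ 2 ≤
        η * ‖toL2 (polyOp (cx P) f)‖ ^ 2 := by
  obtain ⟨K, hK, hweight⟩ := exists_integral_weight_le hb P
  have hscale : Tendsto (fun ξ : Rn n => weight P ((2 * Real.pi) • ξ) ^ 2)
      (cocompact (Rn n)) atTop :=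
    (tendsto_pow_atTop two_ne_zero).comp (hP.comp
      (Homeomorph.smulOfNeZero (2 * Real.pi) (by positivity)).isClosedEmbedding.tendsto_cocompact)
  obtain ⟨r, hr⟩ := Metric.closedBall_compl_subset_of_mem_cocompact
    (hscale.eventually_ge_atTop ((K + 1) / η)) 0
  refine ⟨r, fun f => ?_⟩
  obtain ⟨hint, hle⟩ := hweight f
  calc ∫ ξ in (Metric.closedBall 0 r)ᶜ, ‖𝓕 (toSchwartz f) ξ‖ ^ 2
      ≤ ∫ ξ in (Metric.closedBall 0 r)ᶜ,
          η / (K + 1) * (weight P ((2 * Real.pi) • ξ) ^ 2 * ‖𝓕 (toSchwartz f) ξ‖ ^ 2) := by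
        refine setIntegral_mono_on (integrable_norm_fourier_sq f).integrableOn
          (hint.const_mul _).integrableOn measurableSet_closedBall.compl fun ξ hξ => ?_
        have hlarge : (K + 1) / η ≤ weight P ((2 * Real.pi) • ξ) ^ 2 := hr hξ
        rw [← mul_assoc]
        refine le_mul_of_one_le_left (by positivity) ?_
        rwa [← div_le_iff₀' (by positivity), one_div_div]
    _ ≤ ∫ ξ, η / (K + 1) * (weight P ((2 * Real.pi) • ξ) ^ 2 * ‖𝓕 (toSchwartz f) ξ‖ ^ 2) :=
        setIntegral_le_integral (hint.const_mul _) (ae_of_all _ fun ξ => by positivity)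
    _ ≤ η / (K + 1) * (K * ‖toL2 (polyOp (cx P) f)‖ ^ 2) := by
        rw [integral_const_mul]
        gcongr
    _ = K / (K + 1) * (η * ‖toL2 (polyOp (cx P) f)‖ ^ 2) := by ring
    _ ≤ _ := mul_le_of_le_one_left (by positivity) ((div_le_one (by positivity)).2 (by linarith))

/-- The exponential `x ↦ exp (2πi ⟨x, ξ⟩)` cut off to `Ω`, an element of `L²(ℝⁿ)` when `Ω` is
bounded, whose inner product with a test function on `Ω` is a value of the Fourier transform. -/
def expCut (Ω : Opens (Rn n)) (ξ : Rn n) : Rn n → ℂ :=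
  (Ω : Set (Rn n)).indicator fun x => Complex.exp (I * ((2 * Real.pi * ⟪x, ξ⟫_ℝ : ℝ) : ℂ))

theorem memLp_expCut (hb : Bornology.IsBounded (Ω : Set (Rn n))) (ξ : Rn n) :
    MemLp (expCut Ω ξ) 2 volume := by
  rw [expCut, memLp_indicator_iff_restrict Ω.isOpen.measurableSet]
  have : IsFiniteMeasure (volume.restrict (Ω : Set (Rn n))) :=
    isFiniteMeasure_restrict.2 hb.measure_lt_top.ne
  refine MemLp.of_bound (by fun_prop) 1 (ae_of_all _ fun x => ?_)
  rw [Complex.norm_exp_I_mul_ofReal]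

theorem norm_exp_I_mul_sub_exp_I_mul_le (a b : ℝ) :
    ‖Complex.exp (I * a) - Complex.exp (I * b)‖ ≤ |a - b| := by
  have hfactor : Complex.exp (I * a) - Complex.exp (I * b) =
      Complex.exp (I * b) * (Complex.exp (I * ((a - b : ℝ) : ℂ)) - 1) := by
    rw [mul_sub, mul_one, ← Complex.exp_add]
    congr 2
    push_cast
    ring
  rw [hfactor, norm_mul, Complex.norm_exp_I_mul_ofReal, one_mul]
  exact Real.norm_exp_I_mul_ofReal_sub_one_le

theorem norm_expCut_sub_le {R : ℝ} (hΩ : ∀ x ∈ Ω, ‖x‖ ≤ R) (ξ ζ x : Rn n) :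
    ‖expCut Ω ξ x - expCut Ω ζ x‖ ≤
      2 * Real.pi * R * ‖ξ - ζ‖ * ‖(Ω : Set (Rn n)).indicator (fun _ => (1 : ℂ)) x‖ := by
  by_cases hx : x ∈ (Ω : Set (Rn n))
  · simp only [expCut, Set.indicator_of_mem hx, norm_one, mul_one]
    calc _ ≤ |2 * Real.pi * ⟪x, ξ⟫_ℝ - 2 * Real.pi * ⟪x, ζ⟫_ℝ| :=
          norm_exp_I_mul_sub_exp_I_mul_le _ _
      _ = 2 * Real.pi * |⟪x, ξ - ζ⟫_ℝ| := by
        rw [← mul_sub, ← inner_sub_right, abs_mul, abs_of_nonneg (by positivity)]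
      _ ≤ 2 * Real.pi * (‖x‖ * ‖ξ - ζ‖) := by gcongr; exact abs_real_inner_le_norm _ _
      _ ≤ 2 * Real.pi * (R * ‖ξ - ζ‖) := by gcongr; exact hΩ x hx
      _ = _ := by ring
  · simp [expCut, hx]

theorem continuous_toLp_expCut (hb : Bornology.IsBounded (Ω : Set (Rn n))) :
    Continuous fun ξ => (memLp_expCut hb ξ).toLp := by
  obtain ⟨R, hR, hsub⟩ := hb.subset_closedBall_lt 0 0
  let one : L2Rn n :=
    indicatorConstLp 2 Ω.isOpen.measurableSet hb.measure_lt_top.ne 1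
  refine (LipschitzWith.of_dist_le_mul (K := (2 * Real.pi * R * ‖one‖).toNNReal)
    fun ξ ζ => ?_).continuous
  rw [dist_eq_norm, dist_eq_norm, Real.coe_toNNReal _ (by positivity), ← MemLp.toLp_sub,
    mul_right_comm]
  refine Lp.norm_le_mul_norm_of_ae_le_mul ?_
  filter_upwards [((memLp_expCut hb ξ).sub (memLp_expCut hb ζ)).coeFn_toLp,
    indicatorConstLp_coeFn (p := 2) (hs := Ω.isOpen.measurableSet)
      (hμs := hb.measure_lt_top.ne) (c := (1 : ℂ))] with x hdiff hone
  rw [hdiff, hone]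
  exact norm_expCut_sub_le (fun y hy => mem_closedBall_zero_iff.1 (hsub hy)) ξ ζ x

theorem inner_expCut (hb : Bornology.IsBounded (Ω : Set (Rn n))) (ξ : Rn n) (f : 𝓓(Ω, ℂ)) :
    ⟪(memLp_expCut hb ξ).toLp, toL2 f⟫_ℂ = 𝓕 (toSchwartz f) ξ := by
  rw [L2.inner_def, SchwartzMap.fourier_coe, Real.fourier_eq']
  refine integral_congr_ae ?_
  filter_upwards [(memLp_expCut hb ξ).coeFn_toLp, coeFn_toL2 f] with x hexp hf
  rw [hexp, hf, smul_eq_mul, RCLike.inner_apply, mul_comm]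
  change _ = _ * f x
  by_cases hx : x ∈ (Ω : Set (Rn n))
  · rw [expCut, Set.indicator_of_mem hx, ← Complex.exp_conj, map_mul, Complex.conj_I,
      Complex.conj_ofReal]
    congr 2
    push_cast
    ring
  · rw [image_eq_zero_of_notMem_tsupport fun h => hx (f.tsupport_subset h), mul_zero, mul_zero]

theorem exists_setIntegral_fourier_le (hb : Bornology.IsBounded (Ω : Set (Rn n))) (r : ℝ) {η : ℝ}
    (hη : 0 < η) : ∃ (s : Finset (L2Rn n)) (C : ℝ), ∀ f : 𝓓(Ω, ℂ),
      ∫ ξ in Metric.closedBall 0 r, ‖𝓕 (toSchwartz f) ξ‖ ^ 2 ≤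
        C * ∑ g ∈ s, ‖⟪g, toL2 f⟫_ℂ‖ ^ 2 + η * ‖toL2 f‖ ^ 2 := by
  let v := volume.real (Metric.closedBall (0 : Rn n) r)
  have : 0 ≤ v := measureReal_nonneg
  have hcompact : IsCompact ((fun ξ => (memLp_expCut hb ξ).toLp) '' Metric.closedBall 0 r) :=
    (isCompact_closedBall 0 r).image (continuous_toLp_expCut hb)
  obtain ⟨s, hs⟩ := exists_norm_inner_sq_le_of_isCompact hcompact
    (δ := √(η / (2 * v + 1))) (by positivity)
  refine ⟨s, v * 2, fun f => ?_⟩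
  have hη' : v * (2 * (η / (2 * v + 1))) ≤ η := by
    rw [← mul_assoc, mul_div_assoc', div_le_iff₀ (by positivity)]
    nlinarith
  calc ∫ ξ in Metric.closedBall 0 r, ‖𝓕 (toSchwartz f) ξ‖ ^ 2
      ≤ ∫ _ in Metric.closedBall (0 : Rn n) r, (2 * ∑ g ∈ s, ‖⟪g, toL2 f⟫_ℂ‖ ^ 2 +
          2 * √(η / (2 * v + 1)) ^ 2 * ‖toL2 f‖ ^ 2) := by
        refine setIntegral_mono_on (integrable_norm_fourier_sq f).integrableOn
          (integrableOn_const measure_closedBall_lt_top.ne) measurableSet_closedBall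
          fun ξ hξ => ?_
        rw [← inner_expCut hb]
        exact hs _ ⟨ξ, hξ, rfl⟩ _
    _ = v * 2 * ∑ g ∈ s, ‖⟪g, toL2 f⟫_ℂ‖ ^ 2 +
          v * (2 * (η / (2 * v + 1))) * ‖toL2 f‖ ^ 2 := by
        rw [setIntegral_const, smul_eq_mul, Real.sq_sqrt (by positivity)]
        ring
    _ ≤ _ := by gcongr

theorem exists_norm_toL2_sq_le (hb : Bornology.IsBounded (Ω : Set (Rn n)))
    {P : MvPolynomial (Fin n) ℝ} (hP : Tendsto (weight P) (cocompact (Rn n)) atTop) {η : ℝ}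
    (hη : 0 < η) : ∃ (s : Finset (L2Rn n)) (C : ℝ), ∀ f : 𝓓(Ω, ℂ),
      ‖toL2 f‖ ^ 2 ≤
        C * ∑ g ∈ s, ‖⟪g, toL2 f⟫_ℂ‖ ^ 2 + η * ‖toL2 (polyOp (cx P) f)‖ ^ 2 := by
  obtain ⟨r, hhigh⟩ := exists_setIntegral_fourier_compl_le hb hP (half_pos hη)
  obtain ⟨s, C, hlow⟩ := exists_setIntegral_fourier_le hb r one_half_pos
  refine ⟨s, 2 * C, fun f => ?_⟩
  have hsplit := integral_add_compl (measurableSet_closedBall (x := (0 : Rn n)) (ε := r))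
    (integrable_norm_fourier_sq f)
  rw [integral_norm_fourier_sq] at hsplit
  linarith [hlow f, hhigh f]

end Compactness

/-! ### The form operators -/

section SupportedIn

variable {A B : Set (Rn n)} {f g : L2Rn n}

/-- The functions in `L²(ℝⁿ)` that vanish almost everywhere outside `A`. -/
def supportedIn (A : Set (Rn n)) : Submodule ℂ (L2Rn n) :=
  (LpToLpRestrictCLM (Rn n) ℂ ℂ volume 2 Aᶜ).ker

theorem isClosed_supportedIn (A : Set (Rn n)) : IsClosed (supportedIn A : Set (L2Rn n)) :=
  ContinuousLinearMap.isClosed_ker _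

theorem mem_supportedIn (hA : MeasurableSet A) :
    f ∈ supportedIn A ↔ ∀ᵐ x, x ∉ A → f x = 0 := by
  have hcoe := LpToLpRestrictCLM_coeFn ℂ Aᶜ f
  refine (Lp.eq_zero_iff_ae_eq_zero.trans ⟨hcoe.symm.trans, hcoe.trans⟩).trans ?_
  exact ae_restrict_iff' hA.compl

theorem eq_of_ae_restrict_eq (hA : MeasurableSet A) (hf : f ∈ supportedIn A)
    (hg : g ∈ supportedIn A) (h : f =ᵐ[volume.restrict A] g) : f = g := by
  refine Lp.ext ?_
  filter_upwards [(mem_supportedIn hA).1 hf, (mem_supportedIn hA).1 hg,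
    (ae_restrict_iff' hA).1 h] with x hfx hgx hx
  by_cases hxA : x ∈ A
  · exact hx hxA
  · rw [hfx hxA, hgx hxA]

theorem inner_eq_zero_of_disjoint (hA : MeasurableSet A) (hB : MeasurableSet B)
    (hAB : Disjoint A B) (hf : f ∈ supportedIn A) (hg : g ∈ supportedIn B) : ⟪f, g⟫_ℂ = 0 := by
  rw [L2.inner_def]
  refine integral_eq_zero_of_ae ?_
  filter_upwards [(mem_supportedIn hA).1 hf, (mem_supportedIn hB).1 hg] with x hfx hgx
  by_cases hx : x ∈ A
  · rw [hgx (hAB.notMem_of_mem_left hx), inner_zero_right, Pi.zero_apply]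
  · rw [hfx hx, inner_zero_left, Pi.zero_apply]

theorem toL2_mem_supportedIn (f : 𝓓(Ω, ℂ)) : toL2 f ∈ supportedIn (Ω : Set (Rn n)) := by
  rw [mem_supportedIn Ω.isOpen.measurableSet]
  filter_upwards [coeFn_toL2 f] with x hf hx
  rw [hf]
  exact image_eq_zero_of_notMem_tsupport fun h => hx (f.tsupport_subset h)

end SupportedIn

section Multiplication

variable {m m' : Rn n → ℝ} (hm : MemLp m ∞ volume) (hm' : MemLp m' ∞ volume)

/-- Multiplication by a bounded real valued function, as an operator on `L²(ℝⁿ)`. -/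
def mulL : L2Rn n →L[ℂ] L2Rn n :=
  (ContinuousLinearMap.mul ℂ ℂ).holderL volume ∞ 2 2 (hm.ofReal (K := ℂ)).toLp

theorem coeFn_mulL (f : L2Rn n) : mulL hm f =ᵐ[volume] fun x => (m x : ℂ) * f x := by
  filter_upwards [(ContinuousLinearMap.mul ℂ ℂ).coeFn_holder (r := 2) (hm.ofReal (K := ℂ)).toLp f,
    (hm.ofReal (K := ℂ)).coeFn_toLp] with x hmul hx
  rw [mulL, ContinuousLinearMap.holderL_apply_apply, hmul, hx]
  rfl

theorem mulL_const (c : ℝ) (f : L2Rn n) : mulL (memLp_top_const c) f = (c : ℂ) • f := by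
  refine Lp.ext ?_
  filter_upwards [coeFn_mulL (memLp_top_const c) f, Lp.coeFn_smul (c : ℂ) f] with x hmul hsmul
  rw [hmul, hsmul, Pi.smul_apply, smul_eq_mul]

theorem mulL_mem_supportedIn {A : Set (Rn n)} (hA : MeasurableSet A) {f : L2Rn n}
    (hf : f ∈ supportedIn A) : mulL hm f ∈ supportedIn A := by
  rw [mem_supportedIn hA] at hf ⊢
  filter_upwards [hf, coeFn_mulL hm f] with x hx hmul hxA
  rw [hmul, hx hxA, mul_zero]

theorem inner_mulL_left (f g : L2Rn n) : ⟪mulL hm f, g⟫_ℂ = ⟪f, mulL hm g⟫_ℂ := by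
  rw [L2.inner_def, L2.inner_def]
  refine integral_congr_ae ?_
  filter_upwards [coeFn_mulL hm f, coeFn_mulL hm g] with x hf hg
  rw [hf, hg]
  simp only [RCLike.inner_apply, map_mul, Complex.conj_ofReal]
  ring

theorem re_inner_mulL_mono {A : Set (Rn n)} (hA : MeasurableSet A)
    (hle : ∀ᵐ x ∂volume.restrict A, m x ≤ m' x) {f : L2Rn n} (hf : f ∈ supportedIn A) :
    (⟪mulL hm f, f⟫_ℂ).re ≤ (⟪mulL hm' f, f⟫_ℂ).re := by
  have hre : ∀ (c : ℝ) (z : ℂ), (⟪(c : ℂ) * z, z⟫_ℂ).re = c * ‖z‖ ^ 2 := fun c z => by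
    rw [← smul_eq_mul, inner_smul_left, Complex.conj_ofReal, Complex.re_ofReal_mul]
    exact congrArg _ (inner_self_eq_norm_sq (𝕜 := ℂ) z)
  rw [L2.inner_def, L2.inner_def]
  simp only [← RCLike.re_eq_complex_re]
  rw [← integral_re (L2.integrable_inner _ _), ← integral_re (L2.integrable_inner _ _)]
  refine integral_mono_ae (L2.integrable_inner _ _).re (L2.integrable_inner _ _).re ?_
  filter_upwards [coeFn_mulL hm f, coeFn_mulL hm' f, (mem_supportedIn hA).1 hf,
    (ae_restrict_iff' hA).1 hle] with x hx hx' hfx hlex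
  rw [hx, hx', RCLike.re_eq_complex_re, hre, hre]
  by_cases hxA : x ∈ A
  · exact mul_le_mul_of_nonneg_right (hlex hxA) (sq_nonneg _)
  · rw [hfx hxA, norm_zero, zero_pow two_ne_zero, mul_zero, mul_zero]

theorem re_inner_mulL_const (c : ℝ) (f : L2Rn n) :
    (⟪mulL (memLp_top_const c) f, f⟫_ℂ).re = c * ‖f‖ ^ 2 := by
  rw [mulL_const, inner_smul_left, Complex.conj_ofReal, Complex.re_ofReal_mul]
  exact congrArg _ (inner_self_eq_norm_sq (𝕜 := ℂ) f)

end Multiplication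

section H0

variable {P : MvPolynomial (Fin n) ℝ}

/-- The graph map `φ ↦ (φ, P(D)φ)` of `P(D)` on test functions. -/
def graphMap (P : MvPolynomial (Fin n) ℝ) : 𝓓(Ω, ℂ) →ₗ[ℂ] WithLp 2 (L2Rn n × L2Rn n) :=
  (WithLp.linearEquiv 2 ℂ (L2Rn n × L2Rn n)).symm.toLinearMap ∘ₗ
    toL2.prod (toL2 ∘ₗ polyOp (cx P))

/-- The Hilbert space `H^P_0(Ω)`, realized as the closure of the graph of `P(D)` on test functions.
Its norm is equivalent to `‖P(D)u‖` when `Ω` is bounded. -/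
def H0 (P : MvPolynomial (Fin n) ℝ) (Ω : Opens (Rn n)) :
    Submodule ℂ (WithLp 2 (L2Rn n × L2Rn n)) :=
  (graphMap (Ω := Ω) P).range.topologicalClosure

instance : CompleteSpace (H0 P Ω) :=
  (Submodule.isClosed_topologicalClosure _).completeSpace_coe

namespace H0

/-- The function underlying an element of `H^P_0(Ω)`. -/
def fn : H0 P Ω →L[ℂ] L2Rn n := (WithLp.fstL 2 ℂ _ _).comp (H0 P Ω).subtypeL

/-- The operator `P(D)` on `H^P_0(Ω)`. -/
def op : H0 P Ω →L[ℂ] L2Rn n := (WithLp.sndL 2 ℂ _ _).comp (H0 P Ω).subtypeL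

/-- A test function as an element of `H^P_0(Ω)`. -/
def ofTest (P : MvPolynomial (Fin n) ℝ) (f : 𝓓(Ω, ℂ)) : H0 P Ω :=
  ⟨graphMap P f, Submodule.le_topologicalClosure _ ⟨f, rfl⟩⟩

theorem fn_ofTest (f : 𝓓(Ω, ℂ)) : fn (ofTest P f) = toL2 f := rfl

theorem op_ofTest (f : 𝓓(Ω, ℂ)) : op (ofTest P f) = toL2 (polyOp (cx P) f) := rfl

theorem norm_sq (u : H0 P Ω) : ‖u‖ ^ 2 = ‖fn u‖ ^ 2 + ‖op u‖ ^ 2 :=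
  WithLp.prod_norm_sq_eq_of_L2 u.1

theorem induction {p : L2Rn n → L2Rn n → Prop} (hp : IsClosed {w : L2Rn n × L2Rn n | p w.1 w.2})
    (h : ∀ f : 𝓓(Ω, ℂ), p (toL2 f) (toL2 (polyOp (cx P) f))) (u : H0 P Ω) :
    p (fn u) (op u) := by
  have hclosed : IsClosed {w : WithLp 2 (L2Rn n × L2Rn n) | p w.fst w.snd} :=
    hp.preimage (WithLp.prod_continuous_ofLp 2 _ _)
  exact closure_minimal (Set.range_subset_iff.2 h) hclosed u.2

theorem inner_op (u v : H0 P Ω) : ⟪op u, fn v⟫_ℂ = ⟪fn u, op v⟫_ℂ := by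
  refine induction (p := fun a b => ⟪b, fn v⟫_ℂ = ⟪a, op v⟫_ℂ)
    (isClosed_eq (by fun_prop) (by fun_prop)) (fun f => ?_) u
  exact induction (p := fun a b => ⟪toL2 (polyOp (cx P) f), a⟫_ℂ = ⟪toL2 f, b⟫_ℂ)
    (isClosed_eq (by fun_prop) (by fun_prop)) (fun g => inner_polyOp_cx P f g) v

theorem fn_mem_supportedIn (u : H0 P Ω) : fn u ∈ supportedIn (Ω : Set (Rn n)) :=
  induction (p := fun a _ => a ∈ supportedIn (Ω : Set (Rn n)))
    ((isClosed_supportedIn _).preimage continuous_fst) toL2_mem_supportedIn u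

theorem op_mem_supportedIn (u : H0 P Ω) : op u ∈ supportedIn (Ω : Set (Rn n)) :=
  induction (p := fun _ b => b ∈ supportedIn (Ω : Set (Rn n)))
    ((isClosed_supportedIn _).preimage continuous_snd) (fun _ => toL2_mem_supportedIn _) u

theorem exists_norm_fn_le (hb : Bornology.IsBounded (Ω : Set (Rn n)))
    (hP : Tendsto (weight P) (cocompact (Rn n)) atTop) {ε : ℝ} (hε : 0 < ε) :
    ∃ G : Submodule ℂ (H0 P Ω), FiniteDimensional ℂ G ∧ ∀ u ∈ Gᗮ, ‖fn u‖ ≤ ε * ‖op u‖ := by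
  obtain ⟨s, C, hs⟩ := exists_norm_toL2_sq_le hb hP (pow_pos hε 2)
  refine ⟨Submodule.span ℂ (fn.adjoint '' s),
    FiniteDimensional.span_of_finite ℂ (s.finite_toSet.image _), fun u hu => ?_⟩
  have hzero : ∀ g ∈ s, ⟪g, fn u⟫_ℂ = 0 := fun g hg => by
    rw [← ContinuousLinearMap.adjoint_inner_left]
    exact hu _ (Submodule.subset_span ⟨g, hg, rfl⟩)
  have hle : ‖fn u‖ ^ 2 ≤ C * ∑ g ∈ s, ‖⟪g, fn u⟫_ℂ‖ ^ 2 + ε ^ 2 * ‖op u‖ ^ 2 :=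
    induction (p := fun a b => ‖a‖ ^ 2 ≤ C * ∑ g ∈ s, ‖⟪g, a⟫_ℂ‖ ^ 2 + ε ^ 2 * ‖b‖ ^ 2)
      (isClosed_le (by fun_prop) (by fun_prop)) hs u
  rw [Finset.sum_eq_zero fun g hg => by rw [hzero g hg, norm_zero, zero_pow two_ne_zero],
    mul_zero, zero_add, ← mul_pow] at hle
  exact le_of_sq_le_sq hle (by positivity)

end H0

end H0

section UniqueContinuation

variable {P : MvPolynomial (Fin n) ℝ}

/-- The Carleman weight `x ↦ exp (τ x_j)` cut off to `Ω`. -/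
def expWeight (Ω : Opens (Rn n)) (τ : ℝ) (j : Fin n) : Rn n → ℝ :=
  (Ω : Set (Rn n)).indicator fun x => Real.exp (τ * x j)

theorem memLp_expWeight (hb : Bornology.IsBounded (Ω : Set (Rn n))) (τ : ℝ) (j : Fin n) :
    MemLp (expWeight Ω τ j) ∞ volume := by
  obtain ⟨R, -, hΩ⟩ := exists_abs_coord_le hb
  rw [expWeight, memLp_indicator_iff_restrict Ω.isOpen.measurableSet]
  refine memLp_top_of_bound (by fun_prop) (Real.exp (|τ| * R)) ?_
  filter_upwards [ae_restrict_mem Ω.isOpen.measurableSet] with x hx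
  rw [Real.norm_of_nonneg (Real.exp_pos _).le, Real.exp_le_exp]
  calc τ * x j ≤ |τ| * |x j| := (le_abs_self _).trans (abs_mul _ _).le
    _ ≤ |τ| * R := by gcongr; exact hΩ x hx j

theorem mulL_expWeight_toL2 (hb : Bornology.IsBounded (Ω : Set (Rn n))) (τ : ℝ) (j : Fin n)
    (f : 𝓓(Ω, ℂ)) : mulL (memLp_expWeight hb τ j) (toL2 f) = toL2 (mulExp τ j f) := by
  refine eq_of_ae_restrict_eq Ω.isOpen.measurableSet
    (mulL_mem_supportedIn _ Ω.isOpen.measurableSet (toL2_mem_supportedIn f))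
    (toL2_mem_supportedIn _) ?_
  filter_upwards [ae_restrict_of_ae (coeFn_mulL (memLp_expWeight hb τ j) (toL2 f)),
    ae_restrict_of_ae (coeFn_toL2 f), ae_restrict_of_ae (coeFn_toL2 (mulExp τ j f)),
    ae_restrict_mem Ω.isOpen.measurableSet] with x hmul hf hexp hx
  rw [hmul, hf, hexp, expWeight, Set.indicator_of_mem hx, Complex.ofReal_exp, Complex.ofReal_mul]
  rfl

theorem exists_carleman_H0 (hb : Bornology.IsBounded (Ω : Set (Rn n)))
    (hP : P.totalDegree ≠ 0) : ∃ j, ∃ c > 0, ∀ (τ : ℝ) (u : H0 P Ω),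
      c * |τ| * ‖mulL (memLp_expWeight hb τ j) (H0.fn u)‖ ≤
        ‖mulL (memLp_expWeight hb τ j) (H0.op u)‖ := by
  obtain ⟨R, hR, hΩ⟩ := exists_abs_coord_le hb
  obtain ⟨j, c, hc, hcarleman⟩ := exists_carleman hR hΩ hP
  refine ⟨j, c, hc, fun τ u => ?_⟩
  refine H0.induction (p := fun a b => c * |τ| * ‖mulL (memLp_expWeight hb τ j) a‖ ≤
    ‖mulL (memLp_expWeight hb τ j) b‖) (isClosed_le (by fun_prop) (by fun_prop)) (fun f => ?_) u
  rw [mulL_expWeight_toL2 hb, mulL_expWeight_toL2 hb]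
  exact hcarleman τ f

theorem eq_zero_of_ae_norm_op_le (hb : Bornology.IsBounded (Ω : Set (Rn n)))
    (hP : P.totalDegree ≠ 0) {u : H0 P Ω} {K : ℝ}
    (hK : ∀ᵐ x ∂volume.restrict (Ω : Set (Rn n)), ‖H0.op u x‖ ≤ K * ‖H0.fn u x‖) :
    u = 0 := by
  obtain ⟨j, c, hc, hcarleman⟩ := exists_carleman_H0 (Ω := Ω) hb hP
  have hΩ := Ω.isOpen.measurableSet
  have hle : ∀ᵐ x, ‖H0.op u x‖ ≤ K * ‖H0.fn u x‖ := by
    filter_upwards [(ae_restrict_iff' hΩ).1 hK, (mem_supportedIn hΩ).1 (H0.fn_mem_supportedIn u),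
      (mem_supportedIn hΩ).1 (H0.op_mem_supportedIn u)] with x hx hfn hop
    by_cases hxΩ : x ∈ (Ω : Set (Rn n))
    · exact hx hxΩ
    · rw [hfn hxΩ, hop hxΩ, norm_zero, mul_zero]
  let τ := (|K| + 1) / c
  let M := mulL (memLp_expWeight hb τ j)
  have hM : ‖M (H0.op u)‖ ≤ K * ‖M (H0.fn u)‖ := by
    refine Lp.norm_le_mul_norm_of_ae_le_mul ?_
    filter_upwards [hle, coeFn_mulL (memLp_expWeight hb τ j) (H0.op u),
      coeFn_mulL (memLp_expWeight hb τ j) (H0.fn u)] with x hx hop hfn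
    rw [hop, hfn, norm_mul, norm_mul, mul_left_comm]
    gcongr
  have hMfn : M (H0.fn u) = 0 := by
    have hτ : c * |τ| = |K| + 1 := by
      rw [abs_of_pos (by positivity), mul_div_cancel₀ _ hc.ne']
    have := (hτ ▸ hcarleman τ u).trans hM
    refine norm_le_zero_iff.1 ?_
    nlinarith [le_abs_self K, norm_nonneg (M (H0.fn u))]
  have hfn : H0.fn u = 0 := by
    refine eq_of_ae_restrict_eq hΩ (H0.fn_mem_supportedIn u) (zero_mem _) ?_
    filter_upwards [ae_restrict_of_ae (coeFn_mulL (memLp_expWeight hb τ j) (H0.fn u)),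
      ae_restrict_of_ae ((Lp.eq_zero_iff_ae_eq_zero).1 hMfn),
      ae_restrict_of_ae (Lp.coeFn_zero ℂ 2 volume), ae_restrict_mem hΩ] with x hx hx0 h0 hxΩ
    rw [hx, expWeight, Set.indicator_of_mem hxΩ] at hx0
    rw [h0]
    exact (mul_eq_zero.1 hx0).resolve_left (Complex.ofReal_ne_zero.2 (Real.exp_pos _).ne')
  have hop : ‖H0.op u‖ ≤ K * ‖H0.fn u‖ := Lp.norm_le_mul_norm_of_ae_le_mul hle
  rw [hfn, norm_zero, mul_zero] at hop
  have hnorm := H0.norm_sq u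
  rwa [hfn, norm_le_zero_iff.1 hop, norm_zero, zero_pow two_ne_zero, zero_add, sq_eq_zero_iff,
    norm_eq_zero] at hnorm

end UniqueContinuation

section TransmissionOperator

variable {P : MvPolynomial (Fin n) ℝ} {m : Rn n → ℝ} {hm : MemLp m ∞ volume}

/-- The operator `P(D) - t` on `H^P_0(Ω)`. -/
def H0.opSub (t : ℝ) : H0 P Ω →L[ℂ] L2Rn n := op - (t : ℂ) • fn

theorem H0.opSub_apply (t : ℝ) (u : H0 P Ω) : opSub t u = op u - (t : ℂ) • fn u := rfl

theorem H0.opSub_mem_supportedIn (t : ℝ) (u : H0 P Ω) :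
    opSub t u ∈ supportedIn (Ω : Set (Rn n)) :=
  sub_mem (op_mem_supportedIn u) (Submodule.smul_mem _ _ (fn_mem_supportedIn u))

/-- The operator of the quadratic form `∫ m |(P(D) - t) u|² - t ∫ (P(D) - t) u ū` on `H^P_0(Ω)`.
For `m = 1 / V` and `t ≠ 0` a nonzero kernel makes `t` a transmission eigenvalue. -/
def transOp (P : MvPolynomial (Fin n) ℝ) (Ω : Opens (Rn n)) {m : Rn n → ℝ}
    (hm : MemLp m ∞ volume) (t : ℝ) : H0 P Ω →L[ℂ] H0 P Ω :=
  (H0.opSub t).adjoint ∘L mulL hm ∘L H0.opSub t - H0.fn.adjoint ∘L ((t : ℂ) • H0.opSub t)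

theorem inner_transOp (t : ℝ) (u v : H0 P Ω) : ⟪transOp P Ω hm t u, v⟫_ℂ =
    ⟪mulL hm (H0.opSub t u), H0.opSub t v⟫_ℂ - t * ⟪H0.opSub t u, H0.fn v⟫_ℂ := by
  simp only [transOp, sub_apply, smul_apply, ContinuousLinearMap.comp_apply, inner_sub_left,
    inner_smul_left, Complex.conj_ofReal, ContinuousLinearMap.adjoint_inner_left]

theorem isSelfAdjoint_transOp (t : ℝ) : IsSelfAdjoint (transOp P Ω hm t) := by
  rw [ContinuousLinearMap.isSelfAdjoint_iff_isSymmetric]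
  intro u v
  change ⟪transOp P Ω hm t u, v⟫_ℂ = ⟪u, transOp P Ω hm t v⟫_ℂ
  have hsymm : ⟪H0.opSub t u, H0.fn v⟫_ℂ = ⟪H0.fn u, H0.opSub t v⟫_ℂ := by
    simp only [H0.opSub_apply, inner_sub_left, inner_sub_right, inner_smul_left, inner_smul_right,
      Complex.conj_ofReal, H0.inner_op]
  rw [← inner_conj_symm u, inner_transOp, inner_transOp, inner_mulL_left, map_sub, map_mul,
    inner_conj_symm, inner_conj_symm, Complex.conj_ofReal, hsymm]

theorem continuous_transOp : Continuous (transOp P Ω hm) := by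
  have hsub : Continuous (H0.opSub (P := P) (Ω := Ω)) :=
    continuous_const.sub (Complex.continuous_ofReal.smul continuous_const)
  have hadj : Continuous fun t => (H0.opSub (P := P) (Ω := Ω) t).adjoint :=
    (ContinuousLinearMap.adjoint (𝕜 := ℂ) (E := H0 P Ω)).continuous.comp hsub
  exact (hadj.clm_comp (continuous_const.clm_comp hsub)).sub
    (continuous_const.clm_comp (Complex.continuous_ofReal.smul hsub))

theorem le_reApplyInnerSelf_transOp {κ : ℝ}
    (hκ : ∀ᵐ x ∂volume.restrict (Ω : Set (Rn n)), κ ≤ m x) (t : ℝ) (u : H0 P Ω) :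
    κ * ‖H0.opSub t u‖ ^ 2 - |t| * (‖H0.opSub t u‖ * ‖H0.fn u‖) ≤
      (transOp P Ω hm t).reApplyInnerSelf u := by
  have hform := re_inner_mulL_mono (memLp_top_const κ) hm Ω.isOpen.measurableSet hκ
    (H0.opSub_mem_supportedIn t u)
  have hcross : t * (⟪H0.opSub t u, H0.fn u⟫_ℂ).re ≤ |t| * (‖H0.opSub t u‖ * ‖H0.fn u‖) := by
    refine (le_abs_self _).trans ?_
    rw [abs_mul]
    gcongr
    exact (Complex.abs_re_le_norm _).trans (norm_inner_le_norm _ _)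
  rw [re_inner_mulL_const] at hform
  rw [ContinuousLinearMap.reApplyInnerSelf_apply, inner_transOp, map_sub, RCLike.re_eq_complex_re,
    Complex.re_ofReal_mul]
  linarith

theorem finitelyCoercive_transOp (hb : Bornology.IsBounded (Ω : Set (Rn n)))
    (hP : Tendsto (weight P) (cocompact (Rn n)) atTop) {κ : ℝ} (hκ : 0 < κ)
    (hmκ : ∀ᵐ x ∂volume.restrict (Ω : Set (Rn n)), κ ≤ m x) (t : ℝ) :
    FinitelyCoercive (transOp P Ω hm t) := by
  obtain ⟨ε, hε, hε1, hεt⟩ : ∃ ε > 0, ε ≤ 1 ∧ ε * |t| ≤ min (1 / 2) (κ / 4) := by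
    have hmin : 0 < min (1 / 2) (κ / 4) := by positivity
    refine ⟨min (1 / 2) (κ / 4) / (|t| + 1), by positivity, ?_, ?_⟩
    · rw [div_le_one (by positivity)]
      linarith [min_le_left (1 / 2) (κ / 4), abs_nonneg t]
    · rw [div_mul_eq_mul_div, div_le_iff₀ (by positivity)]
      linarith
  obtain ⟨hεhalf, hεκ⟩ := le_min_iff.1 hεt
  obtain ⟨G, hG, hle⟩ := H0.exists_norm_fn_le hb hP hε
  refine ⟨G, hG, κ / 16, by positivity, fun u hu => ?_⟩
  have hfn := hle u hu
  have hop : ‖H0.op u‖ ≤ ‖H0.opSub t u‖ + |t| * ‖H0.fn u‖ := by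
    have := norm_add_le (H0.opSub t u) ((t : ℂ) • H0.fn u)
    rwa [H0.opSub_apply, sub_add_cancel, norm_smul, Complex.norm_real, Real.norm_eq_abs] at this
  refine le_trans ?_ (le_reApplyInnerSelf_transOp hmκ t u)
  rw [H0.norm_sq]
  have ha := norm_nonneg (H0.fn u)
  have hs := norm_nonneg (H0.opSub t u)
  have hb' := norm_nonneg (H0.op u)
  generalize ‖H0.fn u‖ = a, ‖H0.op u‖ = b, ‖H0.opSub t u‖ = s at *
  have hta : ∀ {C}, ε * |t| ≤ C → |t| * a ≤ C * b := fun {C} hC => by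
    calc |t| * a ≤ |t| * (ε * b) := by gcongr
      _ = ε * |t| * b := by ring
      _ ≤ C * b := by gcongr
  have hbs : b ≤ 2 * s := by linarith [hta hεhalf]
  have hab : a ≤ b := hfn.trans (mul_le_of_le_one_left hb' hε1)
  calc κ / 16 * (a ^ 2 + b ^ 2) ≤ κ / 16 * ((2 * s) ^ 2 + (2 * s) ^ 2) := by
        gcongr
        exact hab.trans hbs
    _ = κ * s ^ 2 - s * (κ / 4 * (2 * s)) := by ring
    _ ≤ κ * s ^ 2 - s * (|t| * a) := by
        have : |t| * a ≤ κ / 4 * (2 * s) := (hta hεκ).trans (by gcongr)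
        gcongr
    _ = _ := by ring

end TransmissionOperator

/-! ### Transmission eigenvalues as kernels -/

section WeakFormulation

variable {P : MvPolynomial (Fin n) ℝ} {u u' f f' : Rn n → ℂ}

theorem memL2Loc_of_memLp (hu : MemLp u 2 volume) : MemL2Loc Ω u := fun _ _ _ => hu.restrict _

theorem MemL2Loc.integrable_mul (hu : MemL2Loc Ω u) (φ : 𝓓(Ω, ℂ)) :
    Integrable fun x => u x * φ x := by
  have hφ : IntegrableOn (fun x => u x * φ x) (tsupport φ) :=
    (hu _ φ.hasCompactSupport φ.tsupport_subset).integrable_mul ((memLp_testFunction φ).restrict _)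
  exact (integrableOn_iff_integrable_of_support_subset fun x (hx : u x * φ x ≠ 0) =>
    subset_tsupport _ (right_ne_zero_of_mul hx)).1 hφ

theorem MemL2Loc.locallyIntegrableOn (hu : MemL2Loc Ω u) :
    LocallyIntegrableOn u (Ω : Set (Rn n)) := by
  rw [locallyIntegrableOn_iff Ω.isOpen.isLocallyClosed]
  intro K hKΩ hK
  have : IsFiniteMeasure ((volume : Measure (Rn n)).restrict K) :=
    ⟨by simpa only [Measure.restrict_apply_univ] using hK.measure_lt_top⟩
  exact (hu K hK hKΩ).integrable one_le_two

/-- `P(D) u = f` on `Ω` in the sense of distributions. -/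
def HasWeakImage (P : MvPolynomial (Fin n) ℝ) (Ω : Opens (Rn n)) (u f : Rn n → ℂ) : Prop :=
  ∀ φ : 𝓓(Ω, ℂ), ∫ x in (Ω : Set (Rn n)), u x * transposeOp P φ x =
    ∫ x in (Ω : Set (Rn n)), f x * φ x

theorem integrable_mul_transposeOp (hu : MemL2Loc Ω u) (φ : 𝓓(Ω, ℂ)) :
    Integrable fun x => u x * transposeOp P φ x := by
  rw [transposeOp_eq_conjTest]
  exact hu.integrable_mul _

theorem solvesIn_iff_hasWeakImage {q : Rn n → ℂ} (hu : MemL2Loc Ω u) (hf : MemL2Loc Ω f)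
    (hqf : ∀ᵐ x ∂volume.restrict (Ω : Set (Rn n)), q x * u x = f x) :
    SolvesIn P Ω q u ↔ HasWeakImage P Ω u f := by
  refine forall_congr' fun φ => ?_
  have heq : ∫ x in (Ω : Set (Rn n)), u x * (transposeOp P φ x - q x * φ x) =
      ∫ x in (Ω : Set (Rn n)), (u x * transposeOp P φ x - f x * φ x) := by
    refine integral_congr_ae ?_
    filter_upwards [hqf] with x hx
    rw [← hx]
    ring
  rw [heq, integral_sub (integrable_mul_transposeOp hu φ).integrableOn
    (hf.integrable_mul φ).integrableOn, sub_eq_zero]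

namespace HasWeakImage

theorem congr (h : HasWeakImage P Ω u f) (hu : u =ᵐ[volume.restrict (Ω : Set (Rn n))] u')
    (hf : f =ᵐ[volume.restrict (Ω : Set (Rn n))] f') : HasWeakImage P Ω u' f' := fun φ =>
  ((integral_congr_ae (hu.mul .rfl)).symm.trans (h φ)).trans (integral_congr_ae (hf.mul .rfl))

theorem const_mul (h : HasWeakImage P Ω u f) (c : ℂ) :
    HasWeakImage P Ω (fun x => c * u x) fun x => c * f x := fun φ => by
  simp only [mul_assoc, integral_const_mul, h φ]

theorem sub (h : HasWeakImage P Ω u f) (h' : HasWeakImage P Ω u' f') (hu : MemL2Loc Ω u)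
    (hu' : MemL2Loc Ω u') (hf : MemL2Loc Ω f) (hf' : MemL2Loc Ω f') :
    HasWeakImage P Ω (fun x => u x - u' x) fun x => f x - f' x := fun φ => by
  simp only [sub_mul]
  rw [integral_sub (integrable_mul_transposeOp hu φ).integrableOn
      (integrable_mul_transposeOp hu' φ).integrableOn,
    integral_sub (hf.integrable_mul φ).integrableOn (hf'.integrable_mul φ).integrableOn,
    h φ, h' φ]

theorem ae_eq (h : HasWeakImage P Ω u f) (h' : HasWeakImage P Ω u f') (hf : MemL2Loc Ω f)
    (hf' : MemL2Loc Ω f') : f =ᵐ[volume.restrict (Ω : Set (Rn n))] f' := by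
  have hzero := Ω.isOpen.ae_eq_zero_of_integral_contDiff_smul_eq_zero
    (hf.locallyIntegrableOn.sub hf'.locallyIntegrableOn) fun g hg hgc hgΩ => ?_
  · filter_upwards [(ae_restrict_iff' Ω.isOpen.measurableSet).2 hzero] with x hx
    exact sub_eq_zero.1 hx
  · let φ : 𝓓(Ω, ℂ) := ⟨fun x => g x, Complex.ofRealCLM.contDiff.comp hg,
      hgc.comp_left Complex.ofReal_zero, (tsupport_comp_subset Complex.ofReal_zero g).trans hgΩ⟩
    have hsupp : ∀ x ∉ (Ω : Set (Rn n)), (f - f') x * φ x = 0 := fun x hx => by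
      rw [image_eq_zero_of_notMem_tsupport fun hxφ => hx (φ.tsupport_subset hxφ), mul_zero]
    calc ∫ x, g x • (f - f') x = ∫ x, (f - f') x * φ x := by
          refine integral_congr_ae (ae_of_all _ fun x => ?_)
          exact (Complex.real_smul).trans (mul_comm _ _)
      _ = ∫ x in (Ω : Set (Rn n)), (f x * φ x - f' x * φ x) := by
          rw [← setIntegral_eq_integral_of_forall_compl_eq_zero hsupp]
          simp only [Pi.sub_apply, sub_mul]
      _ = 0 := by
          rw [integral_sub (hf.integrable_mul φ).integrableOn (hf'.integrable_mul φ).integrableOn,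
            ← h φ, ← h' φ, sub_self]

end HasWeakImage

theorem setIntegral_mul_testFunction (g : L2Rn n) (φ : 𝓓(Ω, ℂ)) :
    ∫ x in (Ω : Set (Rn n)), g x * φ x = ⟪toL2 (conjTest φ), g⟫_ℂ := by
  rw [inner_toL2_left, setIntegral_eq_integral_of_forall_compl_eq_zero fun x hx => ?_]
  · simp only [conjTest_apply, Complex.conj_conj]
  · rw [image_eq_zero_of_notMem_tsupport fun hxφ => hx (φ.tsupport_subset hxφ), mul_zero]

theorem hasWeakImage_iff_inner {g h : L2Rn n} : HasWeakImage P Ω g h ↔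
    ∀ φ : 𝓓(Ω, ℂ), ⟪toL2 (polyOp (cx P) φ), g⟫_ℂ = ⟪toL2 φ, h⟫_ℂ := by
  have hconj : ∀ φ : 𝓓(Ω, ℂ), ∫ x in (Ω : Set (Rn n)), g x * transposeOp P φ x =
      ⟪toL2 (polyOp (cx P) (conjTest φ)), g⟫_ℂ := fun φ => by
    rw [transposeOp_eq_conjTest, setIntegral_mul_testFunction, conjTest_conjTest]
  simp only [HasWeakImage, hconj, setIntegral_mul_testFunction]
  refine ⟨fun hgh φ => ?_, fun hgh φ => hgh (conjTest φ)⟩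
  simpa only [conjTest_conjTest] using hgh (conjTest φ)

theorem HasWeakImage.inner_op {g h : L2Rn n} (hgh : HasWeakImage P Ω g h) (u : H0 P Ω) :
    ⟪H0.op u, g⟫_ℂ = ⟪H0.fn u, h⟫_ℂ :=
  H0.induction (p := fun a b => ⟪b, g⟫_ℂ = ⟪a, h⟫_ℂ)
    (isClosed_eq (by fun_prop) (by fun_prop)) (hasWeakImage_iff_inner.1 hgh) u

theorem H0.hasWeakImage (u : H0 P Ω) : HasWeakImage P Ω (fn u) (op u) :=
  hasWeakImage_iff_inner.2 fun φ => inner_op (ofTest P φ) u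

end WeakFormulation

section MemH0

variable {P : MvPolynomial (Fin n) ℝ}

theorem enorm_toL2_polyOp_sub (f g : 𝓓(Ω, ℂ)) :
    ‖toL2 (polyOp (cx P) f) - toL2 (polyOp (cx P) g)‖ₑ =
      eLpNorm (fun x => diffOp P (f - g : 𝓓(Ω, ℂ)) x) 2 volume := by
  rw [← map_sub, ← map_sub, Lp.enorm_def, diffOp_eq_polyOp]
  exact eLpNorm_congr_ae (coeFn_toL2 _)

theorem enorm_toL2_sub {g : L2Rn n} (hg : g ∈ supportedIn (Ω : Set (Rn n))) (f : 𝓓(Ω, ℂ)) :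
    ‖toL2 f - g‖ₑ = eLpNorm (fun x => f x - g x) 2 (volume.restrict (Ω : Set (Rn n))) := by
  have hΩ := Ω.isOpen.measurableSet
  rw [Lp.enorm_def, ← eLpNorm_indicator_eq_eLpNorm_restrict hΩ]
  refine eLpNorm_congr_ae ?_
  filter_upwards [Lp.coeFn_sub (toL2 f) g, coeFn_toL2 f, (mem_supportedIn hΩ).1 hg,
    (mem_supportedIn hΩ).1 (toL2_mem_supportedIn f)] with x hsub hf hgx hfx
  rw [hsub, Pi.sub_apply]
  by_cases hx : x ∈ (Ω : Set (Rn n))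
  · rw [Set.indicator_of_mem hx, hf]
  · rw [Set.indicator_of_notMem hx, hfx hx, hgx hx, sub_zero]

theorem MemH0.congr {w w' : Rn n → ℂ} (hw : MemH0 P Ω w)
    (h : w =ᵐ[volume.restrict (Ω : Set (Rn n))] w') : MemH0 P Ω w' := by
  obtain ⟨hmem, f, hf, hcauchy⟩ := hw
  refine ⟨hmem.ae_eq h, f, hf.congr fun k => ?_, hcauchy⟩
  exact eLpNorm_congr_ae ((EventuallyEq.refl _ _).sub h)

theorem H0.memH0 (u : H0 P Ω) : MemH0 P Ω (fn u) := by
  refine ⟨(Lp.memLp _).restrict _, ?_⟩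
  obtain ⟨w, hw, hlim⟩ := mem_closure_iff_seq_limit.1 u.2
  choose f hf using hw
  obtain rfl : (fun k => graphMap P (f k)) = w := funext hf
  have hfn : Tendsto (fun k => toL2 (f k)) atTop (𝓝 (fn u)) :=
    ((WithLp.fstL 2 ℂ (L2Rn n) (L2Rn n)).continuous.tendsto _).comp hlim
  have hop : Tendsto (fun k => toL2 (polyOp (cx P) (f k))) atTop (𝓝 (op u)) :=
    ((WithLp.sndL 2 ℂ (L2Rn n) (L2Rn n)).continuous.tendsto _).comp hlim
  refine ⟨f, ?_, ?_⟩
  · simp only [← enorm_toL2_sub (fn_mem_supportedIn u)]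
    simpa only [enorm_zero] using (tendsto_sub_nhds_zero_iff.2 hfn).enorm
  · simp only [← enorm_toL2_polyOp_sub]
    rw [← prod_atTop_atTop_eq]
    simpa only [Function.comp_apply, sub_self, enorm_zero] using
      ((hop.comp (tendsto_fst (g := atTop))).sub (hop.comp (tendsto_snd (f := atTop)))).enorm

theorem MemH0.exists_H0 {w : Rn n → ℂ} (hw : MemH0 P Ω w) :
    ∃ u : H0 P Ω, H0.fn u =ᵐ[volume.restrict (Ω : Set (Rn n))] w := by
  have hΩ := Ω.isOpen.measurableSet
  obtain ⟨hmem, f, hf, hcauchy⟩ := hw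
  obtain ⟨g, hgΩ, hg⟩ : ∃ g ∈ supportedIn (Ω : Set (Rn n)),
      g =ᵐ[volume.restrict (Ω : Set (Rn n))] w := by
    have hind : MemLp ((Ω : Set (Rn n)).indicator w) 2 volume :=
      (memLp_indicator_iff_restrict hΩ).2 hmem
    refine ⟨hind.toLp, (mem_supportedIn hΩ).2 ?_, ?_⟩
    · filter_upwards [hind.coeFn_toLp] with x hx hxΩ
      rw [hx, Set.indicator_of_notMem hxΩ]
    · filter_upwards [ae_restrict_of_ae hind.coeFn_toLp, ae_restrict_mem hΩ] with x hx hxΩ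
      rw [hx, Set.indicator_of_mem hxΩ]
  have hfn : Tendsto (fun k => toL2 (f k)) atTop (𝓝 g) := by
    rw [tendsto_iff_edist_tendsto_0]
    refine hf.congr fun k => ?_
    rw [edist_eq_enorm_sub, enorm_toL2_sub hgΩ]
    exact (eLpNorm_congr_ae ((EventuallyEq.refl _ _).sub hg)).symm
  have hop : CauchySeq fun k => toL2 (polyOp (cx P) (f k)) := by
    refine EMetric.cauchySeq_iff.2 fun ε hε => ?_
    obtain ⟨N, hN⟩ := eventually_atTop.1 (hcauchy.eventually (gt_mem_nhds hε))
    refine ⟨max N.1 N.2, fun k hk l hl => ?_⟩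
    rw [edist_eq_enorm_sub, enorm_toL2_polyOp_sub]
    exact hN (k, l) ⟨(le_max_left _ _).trans hk, (le_max_right _ _).trans hl⟩
  obtain ⟨b, hb⟩ := cauchySeq_tendsto_of_complete hop
  have hlim : Tendsto (fun k => graphMap P (f k)) atTop (𝓝 (WithLp.toLp 2 (g, b))) :=
    ((WithLp.prod_continuous_toLp 2 (L2Rn n) (L2Rn n)).tendsto _).comp (hfn.prodMk_nhds hb)
  exact ⟨⟨_, mem_closure_of_tendsto hlim (.of_forall fun k => ⟨f k, rfl⟩)⟩, hg⟩

end MemH0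

section Eigenvalues

variable {P : MvPolynomial (Fin n) ℝ} {V m : Rn n → ℝ} {t : ℝ}

theorem coeFn_opSub (t : ℝ) (u : H0 P Ω) :
    H0.opSub t u =ᵐ[volume] fun x => H0.op u x - t * H0.fn u x := by
  filter_upwards [Lp.coeFn_sub (H0.op u) ((t : ℂ) • H0.fn u), Lp.coeFn_smul (t : ℂ) (H0.fn u)]
    with x hsub hsmul
  rw [H0.opSub_apply, hsub, Pi.sub_apply, hsmul, Pi.smul_apply, smul_eq_mul]

theorem hasWeakImage_of_transOp_eq_zero {hm : MemLp m ∞ volume} (ht : t ≠ 0) {u : H0 P Ω}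
    (hu : transOp P Ω hm t u = 0) {w : L2Rn n} (hw : mulL hm (H0.opSub t u) = -(t : ℂ) • w) :
    HasWeakImage P Ω w ((t : ℂ) • w - H0.opSub t u : L2Rn n) := by
  refine hasWeakImage_iff_inner.2 fun φ => ?_
  have h := inner_transOp (hm := hm) t u (H0.ofTest P φ)
  rw [hu, hw, inner_zero_left, H0.opSub_apply t (H0.ofTest P φ), inner_sub_right,
    inner_smul_right, H0.fn_ofTest, H0.op_ofTest] at h
  have hconj := congrArg conj h
  simp only [map_zero, map_sub, map_mul, inner_conj_symm, inner_smul_right,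
    Complex.conj_ofReal] at hconj
  refine mul_left_cancel₀ (Complex.ofReal_ne_zero.2 ht) ?_
  rw [inner_sub_right, inner_smul_right]
  linear_combination hconj

theorem HasWeakImage.fn_add {u : H0 P Ω} {w : L2Rn n}
    (hw : HasWeakImage P Ω w ((t : ℂ) • w - H0.opSub t u : L2Rn n)) :
    HasWeakImage P Ω (H0.fn u + w : L2Rn n) ((t : ℂ) • (H0.fn u + w) : L2Rn n) := by
  refine hasWeakImage_iff_inner.2 fun φ => ?_
  rw [inner_add_right, hasWeakImage_iff_inner.1 hw φ,
    hasWeakImage_iff_inner.1 (H0.hasWeakImage u) φ, ← inner_add_right, H0.opSub_apply, smul_add]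
  congr 1
  abel

theorem isTransmissionEigenvalue_of_hasWeakImage {u : H0 P Ω} {w : L2Rn n}
    (hbound : ∀ K : ℝ, ¬ ∀ᵐ x ∂volume.restrict (Ω : Set (Rn n)), ‖H0.op u x‖ ≤ K * ‖H0.fn u x‖)
    {K : ℝ} (hV : ∀ᵐ x ∂volume.restrict (Ω : Set (Rn n)), |V x| ≤ K)
    (hop : ∀ᵐ x ∂volume.restrict (Ω : Set (Rn n)), H0.op u x = t * H0.fn u x - t * V x * w x)
    (hw : HasWeakImage P Ω w ((t : ℂ) • w - H0.opSub t u : L2Rn n)) :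
    IsTransmissionEigenvalue P Ω V t := by
  have hadd := Lp.coeFn_add (H0.fn u) w
  have hL2 : ∀ g : L2Rn n, MemL2Loc Ω g := fun g => memL2Loc_of_memLp (Lp.memLp g)
  refine ⟨(H0.fn u + w : L2Rn n), w, hL2 _, hL2 _, fun hv0 => ?_, fun hw0 => ?_,
    (solvesIn_iff_hasWeakImage (hL2 _) (hL2 _) ?_).2 hw.fn_add,
    (solvesIn_iff_hasWeakImage (hL2 _) (hL2 _) ?_).2 hw, ?_⟩
  · refine hbound (|t| * (1 + K)) ?_
    filter_upwards [hv0, hop, hV, ae_restrict_of_ae hadd] with x hx hopx hVx haddx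
    rw [haddx, Pi.add_apply, Pi.zero_apply, add_comm, add_eq_zero_iff_eq_neg] at hx
    calc ‖H0.op u x‖ = ‖(t : ℂ)‖ * ‖1 + (V x : ℂ)‖ * ‖H0.fn u x‖ := by
          rw [← norm_mul, ← norm_mul, hopx, hx]
          ring_nf
      _ ≤ |t| * (1 + K) * ‖H0.fn u x‖ := by
          rw [Complex.norm_real, Real.norm_eq_abs]
          gcongr
          refine (norm_add_le _ _).trans ?_
          rwa [norm_one, Complex.norm_real, Real.norm_eq_abs, add_le_add_iff_left]
  · refine hbound |t| ?_
    filter_upwards [hw0, hop] with x hx hopx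
    rw [hopx, hx, Pi.zero_apply, mul_zero, sub_zero, norm_mul, Complex.norm_real,
      Real.norm_eq_abs]
  · filter_upwards [ae_restrict_of_ae (Lp.coeFn_smul (t : ℂ) (H0.fn u + w))] with x hx
    rw [hx, Pi.smul_apply, smul_eq_mul]
  · filter_upwards [hop, ae_restrict_of_ae (Lp.coeFn_sub ((t : ℂ) • w) (H0.opSub t u)),
      ae_restrict_of_ae (Lp.coeFn_smul (t : ℂ) w), ae_restrict_of_ae (coeFn_opSub t u)]
      with x hopx hsub hsmul hopSub
    rw [hsub, Pi.sub_apply, hsmul, hopSub, hopx, Pi.smul_apply, smul_eq_mul]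
    ring
  · refine (H0.memH0 u).congr ?_
    filter_upwards [ae_restrict_of_ae hadd] with x hx
    rw [hx, Pi.add_apply, add_sub_cancel_right]

theorem isTransmissionEigenvalue_of_transOp_eq_zero (hb : Bornology.IsBounded (Ω : Set (Rn n)))
    (hP : P.totalDegree ≠ 0) {K : ℝ} (hV : ∀ᵐ x ∂volume.restrict (Ω : Set (Rn n)), |V x| ≤ K)
    {hm : MemLp m ∞ volume} (hVm : ∀ᵐ x ∂volume.restrict (Ω : Set (Rn n)), V x * m x = 1)
    (ht : t ≠ 0) {u : H0 P Ω} (hu : transOp P Ω hm t u = 0) (hu0 : u ≠ 0) :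
    IsTransmissionEigenvalue P Ω V t := by
  obtain ⟨w, hw⟩ : ∃ w : L2Rn n, mulL hm (H0.opSub t u) = -(t : ℂ) • w :=
    ⟨(-(t : ℂ))⁻¹ • _, (smul_inv_smul₀ (neg_ne_zero.2 (Complex.ofReal_ne_zero.2 ht)) _).symm⟩
  refine isTransmissionEigenvalue_of_hasWeakImage
    (fun K hK => hu0 (eq_zero_of_ae_norm_op_le hb hP hK)) hV ?_
    (hasWeakImage_of_transOp_eq_zero ht hu hw)
  have hmul := coeFn_mulL hm (H0.opSub t u)
  rw [hw] at hmul
  filter_upwards [hVm, ae_restrict_of_ae hmul, ae_restrict_of_ae (Lp.coeFn_smul (-(t : ℂ)) w),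
    ae_restrict_of_ae (coeFn_opSub t u)] with x hVmx hmulx hsmul hopSub
  rw [hsmul, hopSub, Pi.smul_apply, smul_eq_mul] at hmulx
  have hVmx' : (V x * m x : ℂ) = 1 := by rw [← Complex.ofReal_mul, hVmx, Complex.ofReal_one]
  linear_combination (H0.fn u x * t - H0.op u x) * hVmx' - V x * hmulx

theorem IsTransmissionEigenvalue.exists_hasWeakImage_opSub {δ : ℝ} (hδ : δ ≠ 0) (ht : t ≠ 0)
    (h : IsTransmissionEigenvalue P Ω (fun _ => δ) t) : ∃ u : H0 P Ω, u ≠ 0 ∧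
      HasWeakImage P Ω (H0.opSub t u) ((t * (1 + δ) : ℂ) • H0.opSub t u : L2Rn n) := by
  obtain ⟨v, w, hv, hw, -, hw0, hvs, hws, hmem⟩ := h
  obtain ⟨u, hu⟩ := hmem.exists_H0
  have hvt : MemL2Loc Ω fun x => t * v x := fun K hK hKΩ => (hv K hK hKΩ).const_mul _
  have hwt : MemL2Loc Ω fun x => t * (1 + δ) * w x := fun K hK hKΩ => (hw K hK hKΩ).const_mul _
  have hvi := (solvesIn_iff_hasWeakImage hv hvt (.of_forall fun _ => rfl)).1 hvs
  have hwi := (solvesIn_iff_hasWeakImage hw hwt (.of_forall fun _ => rfl)).1 hws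
  have hop : H0.op u =ᵐ[volume.restrict (Ω : Set (Rn n))] fun x => t * v x - t * (1 + δ) * w x :=
    (H0.hasWeakImage u).ae_eq ((hvi.sub hwi hv hw hvt hwt).congr hu.symm .rfl)
      (memL2Loc_of_memLp (Lp.memLp _)) fun K hK hKΩ => (hvt K hK hKΩ).sub (hwt K hK hKΩ)
  have hs : H0.opSub t u =ᵐ[volume.restrict (Ω : Set (Rn n))] fun x => -(t * δ) * w x := by
    filter_upwards [hu, hop, ae_restrict_of_ae (coeFn_opSub t u)] with x hux hopx hopSub
    rw [hopSub, hopx, hux]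
    ring
  refine ⟨u, ?_, (hwi.const_mul (-(t * δ))).congr hs.symm ?_⟩
  · rintro rfl
    refine hw0 ?_
    rw [map_zero] at hs
    filter_upwards [hs, ae_restrict_of_ae (Lp.coeFn_zero ℂ 2 volume)] with x hx h0
    rw [h0, Pi.zero_apply, zero_eq_mul] at hx
    exact hx.resolve_left (neg_ne_zero.2 (mod_cast mul_ne_zero ht hδ))
  · filter_upwards [hs, ae_restrict_of_ae (Lp.coeFn_smul (t * (1 + δ) : ℂ) (H0.opSub t u))]
      with x hx hsmul
    rw [hsmul, Pi.smul_apply, hx, smul_eq_mul]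
    ring

theorem norm_opSub_sq_of_hasWeakImage {δ : ℝ} {u : H0 P Ω}
    (h : HasWeakImage P Ω (H0.opSub t u) ((t * (1 + δ) : ℂ) • H0.opSub t u : L2Rn n)) :
    ‖H0.opSub t u‖ ^ 2 = t * δ * (⟪H0.opSub t u, H0.fn u⟫_ℂ).re := by
  have hself : ⟪H0.opSub t u, H0.opSub t u⟫_ℂ = (t * δ : ℝ) * ⟪H0.fn u, H0.opSub t u⟫_ℂ := by
    have hop := h.inner_op u
    calc ⟪H0.opSub t u, H0.opSub t u⟫_ℂ
        = ⟪H0.op u, H0.opSub t u⟫_ℂ - t * ⟪H0.fn u, H0.opSub t u⟫_ℂ := by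
          rw [← Complex.conj_ofReal t, ← inner_smul_left, ← inner_sub_left, H0.opSub_apply]
      _ = (t * δ : ℝ) * ⟪H0.fn u, H0.opSub t u⟫_ℂ := by
          rw [hop, inner_smul_right, Complex.ofReal_mul]
          ring
  rw [← inner_self_eq_norm_sq (𝕜 := ℂ), hself, ← inner_conj_symm (H0.opSub t u),
    RCLike.re_eq_complex_re, Complex.re_ofReal_mul, Complex.conj_re]

end Eigenvalues

/-! ### Eigenfunctions on small balls -/

section Translation

variable {Ω' : Opens (Rn n)} {a : Rn n}

/-- The translate `x ↦ f (x - a)` of a test function. -/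
def translateTest (h : ∀ x, x - a ∈ Ω → x ∈ Ω') (f : 𝓓(Ω, ℂ)) : 𝓓(Ω', ℂ) where
  toFun x := f (x - a)
  contDiff' := f.contDiff.comp (contDiff_id.sub contDiff_const)
  hasCompactSupport' := f.hasCompactSupport.comp_homeomorph (Homeomorph.subRight a)
  tsupport_subset' := fun x hx => h x <| f.tsupport_subset <|
    tsupport_comp_subset_preimage f (Homeomorph.subRight a).continuous hx

theorem testD_translateTest (h : ∀ x, x - a ∈ Ω → x ∈ Ω') (j : Fin n) (f : 𝓓(Ω, ℂ)) :
    testD j (translateTest h f) = translateTest h (testD j f) := by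
  ext x
  change -I * fderiv ℝ (fun x => f (x - a)) x _ = -I * fderiv ℝ f (x - a) _
  rw [fderiv_comp_sub]

theorem polyOp_translateTest (h : ∀ x, x - a ∈ Ω → x ∈ Ω') (Q : MvPolynomial (Fin n) ℂ)
    (f : 𝓓(Ω, ℂ)) : polyOp Q (translateTest h f) = translateTest h (polyOp Q f) := by
  induction Q using MvPolynomial.induction_on generalizing f with
  | C c => rw [polyOp_C, polyOp_C]; rfl
  | add p q hp hq => rw [polyOp_add, polyOp_add, hp, hq]; rfl
  | mul_X p j hp => rw [polyOp_mul, polyOp_mul, polyOp_X, polyOp_X, testD_translateTest, hp]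

/-- The translation `f ↦ f (· - a)` of `L²(ℝⁿ)`. -/
def translateL2 (a : Rn n) : L2Rn n →ₗᵢ[ℂ] L2Rn n :=
  Lp.compMeasurePreservingₗᵢ ℂ (fun x => x - a) (measurePreserving_sub_right volume a)

theorem translateL2_toL2 (h : ∀ x, x - a ∈ Ω → x ∈ Ω') (f : 𝓓(Ω, ℂ)) :
    translateL2 a (toL2 f) = toL2 (translateTest h f) :=
  Lp.toLp_compMeasurePreserving (memLp_testFunction f) (measurePreserving_sub_right volume a)

theorem translateL2_mem_supportedIn {A : Set (Rn n)} (hA : MeasurableSet A) {f : L2Rn n}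
    (hf : f ∈ supportedIn A) : translateL2 a f ∈ supportedIn ((· - a) ⁻¹' A) := by
  have hpres := measurePreserving_sub_right (volume : Measure (Rn n)) a
  refine (mem_supportedIn (hpres.measurable hA)).2 ?_
  filter_upwards [Lp.coeFn_compMeasurePreserving f hpres,
    hpres.quasiMeasurePreserving.ae ((mem_supportedIn hA).1 hf)] with x hx hfx hxA
  exact hx.trans (hfx hxA)

theorem H0.exists_translate {P : MvPolynomial (Fin n) ℝ} (h : ∀ x, x - a ∈ Ω → x ∈ Ω')
    (u : H0 P Ω) :
    ∃ v : H0 P Ω', fn v = translateL2 a (fn u) ∧ op v = translateL2 a (op u) := by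
  have hclosed : IsClosed {w : L2Rn n × L2Rn n |
      WithLp.toLp 2 (translateL2 a w.1, translateL2 a w.2) ∈ H0 P Ω'} :=
    (Submodule.isClosed_topologicalClosure _).preimage
      ((WithLp.prod_continuous_toLp 2 _ _).comp
        (((translateL2 a).continuous.comp continuous_fst).prodMk
          ((translateL2 a).continuous.comp continuous_snd)))
  refine ⟨⟨_, H0.induction (p := fun f g =>
    WithLp.toLp 2 (translateL2 a f, translateL2 a g) ∈ H0 P Ω') hclosed (fun f => ?_) u⟩, rfl, rfl⟩
  rw [translateL2_toL2 h, translateL2_toL2 h, ← polyOp_translateTest]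
  exact (ofTest P (translateTest h f)).2

end Translation

section DisjointSupports

variable {P : MvPolynomial (Fin n) ℝ} {m : Rn n → ℝ} {hm : MemLp m ∞ volume} {t : ℝ}
  {A B : Set (Rn n)} {u v : H0 P Ω}

/-- The elements `u` of `H^P_0(Ω)` such that `u` and `P(D) u` vanish almost everywhere
outside `A`. -/
def H0.supportedIn (P : MvPolynomial (Fin n) ℝ) (Ω : Opens (Rn n)) (A : Set (Rn n)) :
    Submodule ℂ (H0 P Ω) :=
  (AcousticITP.supportedIn A).comap fn.toLinearMap ⊓
    (AcousticITP.supportedIn A).comap op.toLinearMap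

theorem H0.mem_supportedIn : u ∈ H0.supportedIn P Ω A ↔
    fn u ∈ AcousticITP.supportedIn A ∧ op u ∈ AcousticITP.supportedIn A :=
  Iff.rfl

theorem H0.opSub_mem_of_mem_supportedIn (hu : u ∈ H0.supportedIn P Ω A) (t : ℝ) :
    opSub t u ∈ AcousticITP.supportedIn A :=
  sub_mem hu.2 (Submodule.smul_mem _ _ hu.1)

theorem H0.inner_eq_zero_of_disjoint (hA : MeasurableSet A) (hB : MeasurableSet B)
    (hAB : Disjoint A B) (hu : u ∈ H0.supportedIn P Ω A) (hv : v ∈ H0.supportedIn P Ω B) :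
    ⟪u, v⟫_ℂ = 0 := by
  have hinner : ⟪u, v⟫_ℂ = ⟪fn u, fn v⟫_ℂ + ⟪op u, op v⟫_ℂ := WithLp.prod_inner_apply _ _
  obtain ⟨⟨hfu, hou⟩, hfv, hov⟩ := And.intro (H0.mem_supportedIn.1 hu) (H0.mem_supportedIn.1 hv)
  rw [hinner, AcousticITP.inner_eq_zero_of_disjoint hA hB hAB hfu hfv,
    AcousticITP.inner_eq_zero_of_disjoint hA hB hAB hou hov, add_zero]

theorem inner_transOp_eq_zero_of_disjoint (hA : MeasurableSet A) (hB : MeasurableSet B)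
    (hAB : Disjoint A B) (hu : u ∈ H0.supportedIn P Ω A) (hv : v ∈ H0.supportedIn P Ω B) :
    ⟪transOp P Ω hm t u, v⟫_ℂ = 0 := by
  have hsu := H0.opSub_mem_of_mem_supportedIn hu t
  rw [inner_transOp, inner_eq_zero_of_disjoint hA hB hAB (mulL_mem_supportedIn hm hA hsu)
    (H0.opSub_mem_of_mem_supportedIn hv t), inner_eq_zero_of_disjoint hA hB hAB hsu
      (H0.mem_supportedIn.1 hv).1, mul_zero, sub_zero]

theorem reApplyInnerSelf_transOp_nonpos {δ : ℝ} (hδ : δ ≠ 0)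
    (hmδ : ∀ᵐ x ∂volume.restrict (Ω : Set (Rn n)), m x ≤ δ⁻¹)
    (hu : ‖H0.opSub t u‖ ^ 2 = t * δ * (⟪H0.opSub t u, H0.fn u⟫_ℂ).re) :
    (transOp P Ω hm t).reApplyInnerSelf u ≤ 0 := by
  have hle := re_inner_mulL_mono hm (memLp_top_const δ⁻¹) Ω.isOpen.measurableSet hmδ
    (H0.opSub_mem_supportedIn t u)
  rw [ContinuousLinearMap.reApplyInnerSelf_apply, inner_transOp, map_sub, RCLike.re_eq_complex_re,
    Complex.re_ofReal_mul, sub_nonpos]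
  calc _ ≤ δ⁻¹ * ‖H0.opSub t u‖ ^ 2 := hle.trans_eq (re_inner_mulL_const _ _)
    _ = t * (⟪H0.opSub t u, H0.fn u⟫_ℂ).re := by
      rw [hu]
      field_simp

theorem nonposOn_span {H ι : Type*} [NormedAddCommGroup H] [InnerProductSpace ℂ H] [Finite ι]
    {T : H →L[ℂ] H} {w : ι → H} (hoff : Pairwise fun i j => ⟪T (w i), w j⟫_ℂ = 0)
    (hdiag : ∀ i, T.reApplyInnerSelf (w i) ≤ 0) :
    NonposOn T (Submodule.span ℂ (Set.range w)) := by
  have := Fintype.ofFinite ι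
  intro x hx
  obtain ⟨c, rfl⟩ := (Submodule.mem_span_range_iff_exists_fun ℂ).1 hx
  rw [ContinuousLinearMap.reApplyInnerSelf_apply, map_sum, sum_inner, map_sum]
  refine Finset.sum_nonpos fun i _ => ?_
  rw [inner_sum, Finset.sum_eq_single_of_mem i (Finset.mem_univ i) fun j _ hj => ?_]
  · rw [map_smul, inner_smul_left, inner_smul_right, ← mul_assoc, mul_comm (conj _),
      Complex.mul_conj, RCLike.re_eq_complex_re, Complex.re_ofReal_mul]
    exact mul_nonpos_of_nonneg_of_nonpos (Complex.normSq_nonneg _) (hdiag i)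
  · rw [map_smul, inner_smul_left, inner_smul_right, hoff hj.symm, mul_zero, mul_zero]

theorem card_le_nonposIndex_transOp {ι : Type} [Fintype ι] {A : ι → Set (Rn n)} {w : ι → H0 P Ω}
    (hA : ∀ i, MeasurableSet (A i)) (hdisj : Pairwise (Function.onFun Disjoint A))
    (hw0 : ∀ i, w i ≠ 0) (hwA : ∀ i, w i ∈ H0.supportedIn P Ω (A i))
    (hw : ∀ i, (transOp P Ω hm t).reApplyInnerSelf (w i) ≤ 0) :
    (Fintype.card ι : Cardinal) ≤ nonposIndex (transOp P Ω hm t) := by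
  have hlin : LinearIndependent ℂ w := linearIndependent_of_ne_zero_of_inner_eq_zero hw0
    fun i j hij => H0.inner_eq_zero_of_disjoint (hA i) (hA j) (hdisj hij) (hwA i) (hwA j)
  have hspan := nonposOn_span (T := transOp P Ω hm t) (fun i j hij =>
    inner_transOp_eq_zero_of_disjoint (hA i) (hA j) (hdisj hij) (hwA i) (hwA j)) hw
  refine le_trans (le_of_eq ?_) hspan.rank_le_nonposIndex
  rw [rank_span hlin, Cardinal.mk_range_eq _ hlin.injective, Cardinal.mk_fintype]

end DisjointSupports

theorem exists_disjoint_balls {X : Type*} [MetricSpace X] {U : Set X} (hU : IsOpen U)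
    (hinf : U.Infinite) (N : ℕ) : ∃ ε > 0, ∃ a : Fin N → X,
      (∀ i, Metric.ball (a i) ε ⊆ U) ∧
        Pairwise (Function.onFun Disjoint fun i => Metric.ball (a i) ε) := by
  let a : Fin N → X := fun i => hinf.natEmbedding U i
  have ha : Function.Injective a := Subtype.val_injective.comp
    ((hinf.natEmbedding U).injective.comp Fin.val_injective)
  have hsub : ∀ i, ∀ᶠ ε in 𝓝[>] (0 : ℝ), Metric.ball (a i) ε ⊆ U := fun i => by
    obtain ⟨r, hr, hball⟩ := Metric.isOpen_iff.1 hU (a i) (hinf.natEmbedding U i).2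
    filter_upwards [Ioo_mem_nhdsGT hr] with ε hε
    exact (Metric.ball_subset_ball hε.2.le).trans hball
  have hdisj : ∀ i j, ∀ᶠ ε in 𝓝[>] (0 : ℝ),
      i ≠ j → Disjoint (Metric.ball (a i) ε) (Metric.ball (a j) ε) := fun i j => by
    by_cases hij : i = j
    · exact .of_forall fun _ h => absurd hij h
    · filter_upwards [Ioo_mem_nhdsGT (half_pos (dist_pos.2 (ha.ne hij)))] with ε hε _
      exact Metric.ball_disjoint_ball (by linarith [hε.2])
  obtain ⟨ε, ⟨hεsub, hεdisj⟩, hε⟩ := ((eventually_all.2 hsub).and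
    (eventually_all.2 fun i => eventually_all.2 (hdisj i))).and self_mem_nhdsWithin |>.exists
  exact ⟨ε, hε, a, hεsub, fun i j => hεdisj i j⟩

section SmallBalls

variable {P : MvPolynomial (Fin n) ℝ} {m : Rn n → ℝ} {hm : MemLp m ∞ volume} {t δ : ℝ}

theorem exists_translate_of_isTransmissionEigenvalue (hδ : δ ≠ 0) (ht : t ≠ 0) {ε : ℝ}
    (hev : IsTransmissionEigenvalue P (ballO n ε) (fun _ => δ) t)
    (hmδ : ∀ᵐ x ∂volume.restrict (Ω : Set (Rn n)), m x ≤ δ⁻¹) {a : Rn n}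
    (ha : Metric.ball a ε ⊆ Ω) : ∃ w : H0 P Ω, w ≠ 0 ∧
      w ∈ H0.supportedIn P Ω (Metric.ball a ε) ∧
        (transOp P Ω hm t).reApplyInnerSelf w ≤ 0 := by
  obtain ⟨u, hu0, hu⟩ := hev.exists_hasWeakImage_opSub hδ ht
  have hball : (· - a) ⁻¹' (ballO n ε : Set (Rn n)) = Metric.ball a ε := by
    ext x
    exact mem_ball_zero_iff.trans mem_ball_iff_norm.symm
  obtain ⟨w, hfn, hop⟩ := H0.exists_translate (Ω' := Ω)
    (fun x hx => ha (hball.subset hx)) u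
  have hopSub : H0.opSub t w = translateL2 a (H0.opSub t u) := by
    rw [H0.opSub_apply, H0.opSub_apply, hfn, hop, map_sub, map_smul]
  have hnorm : ‖w‖ ^ 2 = ‖u‖ ^ 2 := by
    rw [H0.norm_sq, H0.norm_sq, hfn, hop, LinearIsometry.norm_map, LinearIsometry.norm_map]
  have hmeas := (ballO n ε).isOpen.measurableSet
  refine ⟨w, ?_, H0.mem_supportedIn.2 ⟨?_, ?_⟩, reApplyInnerSelf_transOp_nonpos hδ hmδ ?_⟩
  · rintro rfl
    rw [norm_zero, zero_pow two_ne_zero, eq_comm, sq_eq_zero_iff, norm_eq_zero] at hnorm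
    exact hu0 hnorm
  · rw [← hball, hfn]
    exact translateL2_mem_supportedIn hmeas (H0.fn_mem_supportedIn u)
  · rw [← hball, hop]
    exact translateL2_mem_supportedIn hmeas (H0.op_mem_supportedIn u)
  · rw [hopSub, hfn, LinearIsometry.norm_map, LinearIsometry.inner_map_map,
      norm_opSub_sq_of_hasWeakImage hu]

theorem exists_le_nonposIndex_transOp (hΩ : (Ω : Set (Rn n)).Infinite) (hδ : δ ≠ 0)
    (hmδ : ∀ᵐ x ∂volume.restrict (Ω : Set (Rn n)), m x ≤ δ⁻¹)
    (hball : ∀ ε : ℝ, 0 < ε →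
      ∃ μ : ℝ, μ ≠ 0 ∧ IsTransmissionEigenvalue P (ballO n ε) (fun _ => δ) μ) (N : ℕ) :
    ∃ t, (N : Cardinal) ≤ nonposIndex (transOp P Ω hm t) := by
  obtain ⟨ε, hε, a, hsub, hdisj⟩ := exists_disjoint_balls Ω.isOpen hΩ N
  obtain ⟨t, ht, hev⟩ := hball ε hε
  choose w hw0 hwA hw using fun i =>
    exists_translate_of_isTransmissionEigenvalue (hm := hm) hδ ht hev hmδ (hsub i)
  refine ⟨t, ?_⟩
  simpa only [Fintype.card_fin] using
    card_le_nonposIndex_transOp (fun _ => measurableSet_ball) hdisj hw0 hwA hw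

end SmallBalls

section InfinitelyMany

variable {P : MvPolynomial (Fin n) ℝ} {V m : Rn n → ℝ} {κ δ K : ℝ}

theorem infinite_of_isOpen_of_totalDegree_ne_zero (hP : P.totalDegree ≠ 0) {U : Set (Rn n)}
    (hU : IsOpen U) (hne : U.Nonempty) : U.Infinite := by
  have : Nonempty (Fin n) := by
    by_contra hempty
    rw [not_nonempty_iff] at hempty
    exact hP (by rw [eq_C_of_isEmpty P, totalDegree_C])
  obtain ⟨x, hx⟩ := hne
  have := Module.punctured_nhds_neBot ℝ (Rn n) x
  exact infinite_of_mem_nhds x (hU.mem_nhds hx)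

theorem setOf_ker_transOp_ne_bot_subset (hb : Bornology.IsBounded (Ω : Set (Rn n)))
    (hP : P.totalDegree ≠ 0) (hV : ∀ᵐ x ∂volume.restrict (Ω : Set (Rn n)), |V x| ≤ K)
    {hm : MemLp m ∞ volume} (hVm : ∀ᵐ x ∂volume.restrict (Ω : Set (Rn n)), V x * m x = 1) :
    {t : ℝ | (transOp P Ω hm t).ker ≠ ⊥} ⊆
      insert 0 {t : ℝ | IsTransmissionEigenvalue P Ω V t} := by
  intro t hker
  obtain ⟨u, hu, hu0⟩ := Submodule.exists_mem_ne_zero_of_ne_bot hker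
  refine (eq_or_ne t 0).imp_right fun ht => ?_
  exact isTransmissionEigenvalue_of_transOp_eq_zero hb hP hV hVm ht hu hu0

theorem infinite_setOf_isTransmissionEigenvalue (hP : P.totalDegree ≠ 0)
    (hPweight : Tendsto (weight P) (cocompact (Rn n)) atTop)
    (hne : (Ω : Set (Rn n)).Nonempty) (hb : Bornology.IsBounded (Ω : Set (Rn n)))
    (hV : ∀ᵐ x ∂volume.restrict (Ω : Set (Rn n)), |V x| ≤ K) (hm : MemLp m ∞ volume)
    (hVm : ∀ᵐ x ∂volume.restrict (Ω : Set (Rn n)), V x * m x = 1) (hκ : 0 < κ)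
    (hmκ : ∀ᵐ x ∂volume.restrict (Ω : Set (Rn n)), κ ≤ m x) (hδ : δ ≠ 0)
    (hmδ : ∀ᵐ x ∂volume.restrict (Ω : Set (Rn n)), m x ≤ δ⁻¹)
    (hball : ∀ ε : ℝ, 0 < ε →
      ∃ μ : ℝ, μ ≠ 0 ∧ IsTransmissionEigenvalue P (ballO n ε) (fun _ => δ) μ) :
    {μ : ℝ | IsTransmissionEigenvalue P Ω V μ}.Infinite := by
  intro hfin
  obtain ⟨N, hN⟩ := exists_nonposIndex_le_of_finite_singular
    (continuous_transOp (P := P) (Ω := Ω) (hm := hm)) isSelfAdjoint_transOp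
    (finitelyCoercive_transOp hb hPweight hκ hmκ)
    ((hfin.insert 0).subset (setOf_ker_transOp_ne_bot_subset hb hP hV hVm))
  obtain ⟨t, ht⟩ := exists_le_nonposIndex_transOp (hm := hm)
    (infinite_of_isOpen_of_totalDegree_ne_zero hP Ω.isOpen hne) hδ hmδ hball (N + 1)
  exact absurd (Nat.cast_le.1 (ht.trans (hN t))) N.not_succ_le_self

theorem ae_abs_le_of_memLp_top {α : Type*} [MeasurableSpace α] {μ : Measure α} {f : α → ℝ}
    (hf : MemLp f ∞ μ) : ∀ᵐ x ∂μ, |f x| ≤ (eLpNorm f ∞ μ).toReal := by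
  filter_upwards [ae_le_eLpNormEssSup (f := f) (μ := μ)] with x hx
  rw [← eLpNorm_exponent_top] at hx
  simpa only [toReal_enorm, Real.norm_eq_abs] using ENNReal.toReal_mono hf.2.ne hx

theorem memLp_top_indicator_inv {α : Type*} [MeasurableSpace α] {μ : Measure α} {f : α → ℝ}
    {s : Set α} (hs : MeasurableSet s) (hf : AEMeasurable f (μ.restrict s)) (hδ : 0 < δ)
    (hδf : ∀ᵐ x ∂μ.restrict s, δ ≤ f x) : MemLp (s.indicator fun x => (f x)⁻¹) ∞ μ := by
  refine (memLp_indicator_iff_restrict hs).2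
    (memLp_top_of_bound hf.inv.aestronglyMeasurable δ⁻¹ ?_)
  filter_upwards [hδf] with x hx
  rw [norm_inv, Real.norm_of_nonneg (hδ.le.trans hx)]
  exact inv_anti₀ hδ hx

end InfinitelyMany

end AcousticITP

end

theorem proposition6p2_general {n : ℕ} (P : MvPolynomial (Fin n) ℝ) (hP : P.totalDegree ≠ 0)
    (hPweight : Tendsto (AcousticITP.weight P) (cocompact (AcousticITP.Rn n)) atTop)
    (Ω : TopologicalSpace.Opens (AcousticITP.Rn n))
    (hΩne : (Ω : Set (AcousticITP.Rn n)).Nonempty)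
    (hΩbdd : Bornology.IsBounded (Ω : Set (AcousticITP.Rn n)))
    (V : AcousticITP.Rn n → ℝ)
    (hV : MemLp V ∞ (volume.restrict (Ω : Set (AcousticITP.Rn n))))
    {δ₀ : ℝ} (hδ₀ : 0 < δ₀)
    (hVδ₀ : ∀ᵐ x ∂volume.restrict (Ω : Set (AcousticITP.Rn n)), δ₀ ≤ V x)
    (hball : ∀ ε : ℝ, 0 < ε → ∃ μ : ℝ, μ ≠ 0 ∧
      AcousticITP.IsTransmissionEigenvalue P (AcousticITP.ballO n ε) (fun _ => δ₀) (μ : ℂ)) :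
    {μ : ℝ | AcousticITP.IsTransmissionEigenvalue P Ω V (μ : ℂ)}.Infinite := by
  have hΩ : MeasurableSet (Ω : Set (AcousticITP.Rn n)) := Ω.isOpen.measurableSet
  have hVK := AcousticITP.ae_abs_le_of_memLp_top hV
  set K := (eLpNorm V ∞ (volume.restrict (Ω : Set (AcousticITP.Rn n)))).toReal
  have hK : 0 < K + 1 := by positivity
  refine AcousticITP.infinite_setOf_isTransmissionEigenvalue hP hPweight hΩne hΩbdd hVK
    (AcousticITP.memLp_top_indicator_inv hΩ hV.1.aemeasurable hδ₀ hVδ₀) ?_ (inv_pos.2 hK) ?_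
    hδ₀.ne' ?_ hball
  all_goals
    filter_upwards [ae_restrict_mem hΩ, hVδ₀, hVK] with x hxΩ hδx hKx
    have hpos := hδ₀.trans_le hδx
    rw [Set.indicator_of_mem hxΩ]
  · exact mul_inv_cancel₀ hpos.ne'
  · exact inv_anti₀ hpos ((le_abs_self _).trans (hKx.trans (lt_add_one K).le))
  · exact inv_anti₀ hδ₀ hδx

theorem proposition6p2 {n : ℕ} (P : MvPolynomial (Fin n) ℝ) (hP : 2 ≤ P.totalDegree)
    (hPweight : Tendsto (AcousticITP.weight P) (cocompact (AcousticITP.Rn n)) atTop)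
    (Ω : TopologicalSpace.Opens (AcousticITP.Rn n))
    (hΩconn : IsConnected (Ω : Set (AcousticITP.Rn n)))
    (hΩbdd : Bornology.IsBounded (Ω : Set (AcousticITP.Rn n)))
    (V : AcousticITP.Rn n → ℝ) (hV : MemLp V ∞ volume)
    (hVsupp : AcousticITP.essSupport V = closure (Ω : Set (AcousticITP.Rn n)))
    (hVpos : ∃ δ₀ : ℝ, 0 < δ₀ ∧
      ∀ᵐ x ∂(volume.restrict (closure (Ω : Set (AcousticITP.Rn n)))), δ₀ ≤ V x)
    (hball : ∀ ε δ : ℝ, 0 < ε → 0 < δ → ∃ μ : ℝ, μ ≠ 0 ∧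
      AcousticITP.IsTransmissionEigenvalue P (AcousticITP.ballO n ε) (fun _ => δ) (μ : ℂ)) :
    {μ : ℝ | AcousticITP.IsTransmissionEigenvalue P Ω V (μ : ℂ)}.Infinite := by
  obtain ⟨δ₀, hδ₀, hVδ₀⟩ := hVpos
  exact proposition6p2_general P (by omega) hPweight Ω hΩconn.nonempty hΩbdd V (hV.restrict _) hδ₀
    (ae_restrict_of_ae_restrict_of_subset subset_closure hVδ₀) fun ε hε => hball ε δ₀ hε hδ₀
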